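/- Let $M$ be a compact (Hausdorff) smooth 3-manifold without boundary, let $1\le r\le\infty$, and let $\eta$ be a $C^r$ plane field on $M$, i.e. a rank-two $C^r$ subbundle of the tangent bundle $TM$. Let $\Gamma(\eta)$ denote the space of $C^r$ sections of $\eta$ (that is, $C^r$ vector fields $X$ on $M$ with $X(p)\in\eta(p)$ for all $p\in M$), equipped with the $C^r$ topology. Then there is an open dense subset $\mathcal U\subset\Gamma(\eta)$ such that for every $X\in\mathcal U$ the fixed point set $\{p\in M : X(p)=0\}$ is a finite link of class $C^r$, i.e. a union of finitely many (possibly zero) pairwise disjoint $C^r$-embedded circles in $M$. -/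

import Mathlib

open Set Topology Manifold
open scoped ContDiff UniformConvergence

noncomputable section

/-- A `C^r` plane field on a 3-manifold `M`: a rank two `C^r` subbundle of the tangent bundle,
i.e. a choice of a plane in every tangent space that is locally spanned by two `C^r` vector
fields. -/
structure PlaneField (r : ℕ∞) (M : Type*) [TopologicalSpace M]
    [ChartedSpace (EuclideanSpace ℝ (Fin 3)) M] [IsManifold (𝓡 3) ∞ M] where
  /-- The plane at each point. -/
  plane : ∀ p : M, Submodule ℝ (TangentSpace (𝓡 3) p)
  finrank_plane : ∀ p : M, Module.finrank ℝ (plane p) = 2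
  exists_local_frame : ∀ p : M, ∃ U : Set M, IsOpen U ∧ p ∈ U ∧
    ∃ V W : ∀ q : M, TangentSpace (𝓡 3) q,
      ContMDiffOn (𝓡 3) (𝓡 3).tangent r
        (fun q ↦ (⟨q, V q⟩ : TangentBundle (𝓡 3) M)) U ∧
      ContMDiffOn (𝓡 3) (𝓡 3).tangent r
        (fun q ↦ (⟨q, W q⟩ : TangentBundle (𝓡 3) M)) U ∧
      ∀ q ∈ U, plane q = Submodule.span ℝ {V q, W q}

namespace PlaneField

variable {r : ℕ∞} {M : Type*} [TopologicalSpace M]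
  [ChartedSpace (EuclideanSpace ℝ (Fin 3)) M] [IsManifold (𝓡 3) ∞ M]

/-- The space `Γ(η)` of `C^r` sections of `η`: the `C^r` vector fields on `M` tangent to `η`. -/
def Sections (η : PlaneField r M) : Type _ :=
  {X : ContMDiffSection (𝓡 3) (EuclideanSpace ℝ (Fin 3)) r
      (fun p : M ↦ TangentSpace (𝓡 3) p) // ∀ p : M, X p ∈ η.plane p}

namespace Sections

variable {η : PlaneField r M}

/-- The vector field underlying a section of `η`. -/
def toField (X : η.Sections) (p : M) : TangentSpace (𝓡 3) p := X.1 p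

/-- The expression of `X` in the preferred chart at `c`, with respect to the coordinate frame of
that chart; only its values on the target of the chart are meaningful. -/
def localRep (X : η.Sections) (c : M) :
    EuclideanSpace ℝ (Fin 3) → EuclideanSpace ℝ (Fin 3) := fun u ↦
  (trivializationAt (EuclideanSpace ℝ (Fin 3)) (TangentSpace (𝓡 3) : M → Type _) c
    ⟨(chartAt (EuclideanSpace ℝ (Fin 3)) c).symm u,
      X.toField ((chartAt (EuclideanSpace ℝ (Fin 3)) c).symm u)⟩).2

/-- The `C^r` topology on `Γ(η)`: uniform convergence, on compact subsets of charts, of all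
partial derivatives of order `k ≤ r` (all finite `k` if `r = ∞`) of the local expressions. -/
instance : TopologicalSpace η.Sections :=
  ⨅ (c : M) (k : ℕ) (_ : (k : ℕ∞) ≤ r), TopologicalSpace.induced
    (fun X : η.Sections ↦
      UniformOnFun.ofFun
        {K : Set (EuclideanSpace ℝ (Fin 3)) |
          IsCompact K ∧ K ⊆ (chartAt (EuclideanSpace ℝ (Fin 3)) c).target}
        (iteratedFDeriv ℝ k (X.localRep c)))
    inferInstance

/-- The fixed point set of (the flow of) `X`, i.e. the set of its zeros. -/
def fixedPoints (X : η.Sections) : Set M := {p | X.toField p = 0}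

end Sections

end PlaneField

/-- `L` is a finite link of class `C^r`: the union of finitely many (possibly no) pairwise
disjoint `C^r` embedded circles. -/
def IsFiniteLink (r : ℕ∞) {M : Type*} [TopologicalSpace M]
    [ChartedSpace (EuclideanSpace ℝ (Fin 3)) M] (L : Set M) : Prop :=
  ∃ (n : ℕ) (γ : Fin n → Circle → M),
    (∀ i, IsSmoothEmbedding (𝓡 1) (𝓡 3) r (γ i)) ∧
    (∀ i j, i ≠ j → Disjoint (range (γ i)) (range (γ j))) ∧
    L = ⋃ i, range (γ i)

end

/-! Locally a plane field is the graph of a linear map over a fixed coordinate plane: in a chart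
there are a projection `π` to the plane and a `C^r` family `S u` with `π ∘ S u = id` whose image is
the field. A section satisfies `X = S (π X)`, so its zeros are those of `π X`, a map from three
variables to two. Where zero is a regular value of `π X`, the zero set is a `C^r` curve. The set `𝒰`
consists of the sections with this property on finitely many compact sets whose interiors cover `M`.

Openness (`isOpen_regularOn`) holds because regularity on a compact set is an open condition on
1-jets. Density (`dense_regularOn`) comes from a dimension count: the affine perturbations `b` for
which `F + b` has a degenerate zero lie in the union of two `C¹` images of a 7-dimensional space
inside an 8-dimensional one (`dense_affine_perturbations`). The count differentiates `fderiv F` and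
so needs `F` of class `C²`. For `r = 1` this is not available, hence `F` is first mollified. The
mollification is jointly `C^r` in scale and point (`exists_mollification`), so the perturbed
sections converge to `X` in the `C^r` topology.

It remains to recognise a compact set `L` that is a coordinate axis in suitable charts as a finite
link (`isFiniteLink_of_isStraight`). An embedding of `M` in a Euclidean space measures arc length on
`L`. Arc length parametrizations differ by maps `t ↦ c ± t`, which is recorded in `UnitAtlas`. Unit
speed curves continue uniquely and for all time by compactness, must return to an earlier point, and
are then periodic (`exists_closed_curve`). Each component of `L` is thus an embedded circle, open in
`L`, and compactness leaves finitely many. -/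

noncomputable section

/-! ### Germs and unique continuation of unit speed curves -/

/-- A family of arcs through the points of `N` that are homeomorphisms onto open sets and differ
from each other by isometries `t ↦ c ± t` of the line. -/
structure UnitAtlas (N : Type*) [TopologicalSpace N] where
  /-- The arc through a point. -/
  arc : N → ℝ → N
  /-- Half of the length of an arc. -/
  rad : N → ℝ
  rad_pos : ∀ p, 0 < rad p
  arc_zero : ∀ p, arc p 0 = p
  continuousOn : ∀ p, ContinuousOn (arc p) (Ioo (-rad p) (rad p))
  injOn : ∀ p, InjOn (arc p) (Ioo (-rad p) (rad p))
  isOpen_image : ∀ p, ∀ U ⊆ Ioo (-rad p) (rad p), IsOpen U → IsOpen (arc p '' U)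
  compat : ∀ p q s t, s ∈ Ioo (-rad p) (rad p) → t ∈ Ioo (-rad q) (rad q) →
    arc p s = arc q t → ∃ σ : ℝ, (σ = 1 ∨ σ = -1) ∧ ∀ᶠ u in 𝓝 0, arc p (s + u) = arc q (t + σ * u)

namespace UnitAtlas

variable {N : Type*} [TopologicalSpace N] (A : UnitAtlas N)

/-- The curve `γ` runs through the arcs of the atlas with unit speed near the time `t`. -/
def IsUnitAt (γ : ℝ → N) (t : ℝ) : Prop :=
  ∃ σ : ℝ, (σ = 1 ∨ σ = -1) ∧ ∀ᶠ u in 𝓝 0, γ (t + u) = A.arc (γ t) (σ * u)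

variable {A} {γ γ₁ γ₂ : ℝ → N} {s t : ℝ}

lemma zero_mem (p : N) : (0 : ℝ) ∈ Ioo (-A.rad p) (A.rad p) := by
  have := A.rad_pos p
  constructor <;> linarith

lemma tendsto_affine (a σ : ℝ) : Filter.Tendsto (fun u : ℝ ↦ a + σ * u) (𝓝 0) (𝓝 a) := by
  have : Continuous fun u : ℝ ↦ a + σ * u := by fun_prop
  simpa using this.tendsto 0

lemma tendsto_mul_zero (σ : ℝ) : Filter.Tendsto (fun u : ℝ ↦ σ * u) (𝓝 0) (𝓝 0) := by
  have : Continuous fun u : ℝ ↦ σ * u := by fun_prop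
  simpa using this.tendsto 0

lemma sign_mul {σ τ : ℝ} (hσ : σ = 1 ∨ σ = -1) (hτ : τ = 1 ∨ τ = -1) : σ * τ = 1 ∨ σ * τ = -1 := by
  rcases hσ with rfl | rfl <;> rcases hτ with rfl | rfl <;> simp

lemma sign_mul_self {σ : ℝ} (hσ : σ = 1 ∨ σ = -1) : σ * σ = 1 := by
  rcases hσ with rfl | rfl <;> simp

lemma eventually_add_iff {P : ℝ → Prop} {t : ℝ} : (∀ᶠ u in 𝓝 0, P (t + u)) ↔ ∀ᶠ x in 𝓝 t, P x := by
  rw [← map_add_left_nhds_zero t, Filter.eventually_map]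

/-- The arc centred at `γ t` can be traded, through `compat`, for any arc through that point, at the
cost of a sign. The next lemma is the converse. -/
lemma IsUnitAt.exists_arc (h : A.IsUnitAt γ t) {q : N} {s : ℝ} (hs : s ∈ Ioo (-A.rad q) (A.rad q))
    (hq : γ t = A.arc q s) :
    ∃ σ : ℝ, (σ = 1 ∨ σ = -1) ∧ ∀ᶠ u in 𝓝 0, γ (t + u) = A.arc q (s + σ * u) := by
  obtain ⟨σ, hσ, hu⟩ := h
  obtain ⟨τ, hτ, hv⟩ := A.compat (γ t) q 0 s (zero_mem _) hs (by rw [A.arc_zero, hq])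
  refine ⟨τ * σ, sign_mul hτ hσ, ?_⟩
  filter_upwards [hu, (tendsto_mul_zero σ).eventually hv] with u h1 h2
  rw [h1, ← zero_add (σ * u), h2, mul_assoc]

lemma isUnitAt_of_arc {q : N} {s σ : ℝ} (hs : s ∈ Ioo (-A.rad q) (A.rad q)) (hσ : σ = 1 ∨ σ = -1)
    (h : ∀ᶠ u in 𝓝 0, γ (t + u) = A.arc q (s + σ * u)) : A.IsUnitAt γ t := by
  have h0 : γ t = A.arc q s := by simpa using h.self_of_nhds
  obtain ⟨τ, hτ, hv⟩ := A.compat q (γ t) s 0 hs (zero_mem _) (by rw [A.arc_zero, h0])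
  refine ⟨τ * σ, sign_mul hτ hσ, ?_⟩
  filter_upwards [h, (tendsto_mul_zero σ).eventually hv] with u h1 h2
  rw [h1, h2, zero_add, mul_assoc]

lemma isUnitAt_arc {q : N} (hs : s ∈ Ioo (-A.rad q) (A.rad q)) : A.IsUnitAt (A.arc q) s :=
  isUnitAt_of_arc hs (Or.inl rfl) (by simp)

lemma IsUnitAt.congr (h : A.IsUnitAt γ₁ t) (he : ∀ᶠ u in 𝓝 0, γ₁ (t + u) = γ₂ (s + u)) :
    A.IsUnitAt γ₂ s := by
  obtain ⟨σ, hσ, hu⟩ := h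
  refine ⟨σ, hσ, ?_⟩
  have h0 : γ₁ t = γ₂ s := by simpa using he.self_of_nhds
  filter_upwards [hu, he] with u h1 h2
  rw [← h2, h1, h0]

lemma IsUnitAt.comp_affine {a σ : ℝ} (hσ : σ = 1 ∨ σ = -1) (h : A.IsUnitAt γ (a + σ * t)) :
    A.IsUnitAt (fun u ↦ γ (a + σ * u)) t := by
  obtain ⟨τ, hτ, hu⟩ := h
  refine ⟨τ * σ, sign_mul hτ hσ, ?_⟩
  filter_upwards [(tendsto_mul_zero σ).eventually hu] with u h1
  simp only [mul_add, ← add_assoc, h1, mul_assoc]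

lemma IsUnitAt.continuousAt (h : A.IsUnitAt γ t) : ContinuousAt γ t := by
  obtain ⟨σ, hσ, hu⟩ := h
  have h1 : ContinuousAt (A.arc (γ t)) 0 :=
    (A.continuousOn (γ t)).continuousAt (isOpen_Ioo.mem_nhds (zero_mem _))
  have h2 : Filter.Tendsto (fun u ↦ γ (t + u)) (𝓝 0) (𝓝 (γ t)) := by
    refine Filter.Tendsto.congr' (hu.mono fun _ h ↦ h.symm) ?_
    have := h1.tendsto.comp (tendsto_mul_zero σ)
    rwa [A.arc_zero] at this
  rw [ContinuousAt, ← map_add_left_nhds_zero t, Filter.tendsto_map'_iff]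
  exact h2

lemma IsUnitAt.exists_injOn (h : A.IsUnitAt γ t) : ∃ δ > 0, InjOn γ (Ioo (t - δ) (t + δ)) := by
  obtain ⟨σ, hσ, hu⟩ := h
  have hm := (tendsto_mul_zero σ).eventually (isOpen_Ioo.mem_nhds (zero_mem (A := A) (γ t)))
  obtain ⟨δ, hδ, hb⟩ := Metric.eventually_nhds_iff.1 (hu.and hm)
  refine ⟨δ, hδ, fun x hx y hy hxy ↦ ?_⟩
  have hx' := @hb (x - t) (by rw [Real.dist_eq, abs_lt]; constructor <;> linarith [hx.1, hx.2])
  have hy' := @hb (y - t) (by rw [Real.dist_eq, abs_lt]; constructor <;> linarith [hy.1, hy.2])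
  rw [add_sub_cancel] at hx' hy'
  have := A.injOn _ hx'.2 hy'.2 (by rw [← hx'.1, ← hy'.1, hxy])
  rcases hσ with rfl | rfl <;> linarith

lemma IsUnitAt.same_or_reverse (h₁ : A.IsUnitAt γ₁ s) (h₂ : A.IsUnitAt γ₂ t) (h : γ₁ s = γ₂ t) :
    ∃ σ : ℝ, (σ = 1 ∨ σ = -1) ∧ ∀ᶠ u in 𝓝 0, γ₁ (s + u) = γ₂ (t + σ * u) := by
  obtain ⟨σ, hσ, h1⟩ := h₁
  obtain ⟨τ, hτ, h2⟩ := h₂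
  refine ⟨τ * σ, sign_mul hτ hσ, ?_⟩
  filter_upwards [h1, (tendsto_mul_zero (τ * σ)).eventually h2] with u h3 h4
  rw [h3, h4, h, ← mul_assoc, ← mul_assoc, sign_mul_self hτ, one_mul]

/-- A unit speed curve is not its own reflection at a time. -/
lemma IsUnitAt.not_reflection (h : A.IsUnitAt γ t)
    (hr : ∀ᶠ u in 𝓝 0, γ (t + u) = γ (t - u)) : False := by
  obtain ⟨δ, hδ, hi⟩ := h.exists_injOn
  obtain ⟨ε, hε, he⟩ := Metric.eventually_nhds_iff.1 hr
  set u := min δ ε / 2 with hu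
  have h1 : u < δ := by have := min_le_left δ ε; have := lt_min hδ hε; linarith
  have h2 : u < ε := by have := min_le_right δ ε; have := lt_min hδ hε; linarith
  have h3 : 0 < u := half_pos (lt_min hδ hε)
  have := hi (by constructor <;> linarith) (by constructor <;> linarith)
    (@he u (by rwa [Real.dist_eq, sub_zero, abs_of_pos h3]))
  linarith

variable [T2Space N]

/-- Unique continuation. The agreement set is open, so only its limit points in `I` matter. There
the values agree by continuity, so the germs agree up to direction. -/
lemma eqOn_of_germ {I : Set ℝ} (hI : IsPreconnected I) (h₁ : ∀ t ∈ I, A.IsUnitAt γ₁ t)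
    (h₂ : ∀ t ∈ I, A.IsUnitAt γ₂ t) {t₀ : ℝ} (ht₀ : t₀ ∈ I) (h : γ₁ =ᶠ[𝓝 t₀] γ₂) :
    ∀ t ∈ I, γ₁ =ᶠ[𝓝 t] γ₂ := by
  have hopen : IsOpen {t | γ₁ =ᶠ[𝓝 t] γ₂} := isOpen_setOfPred_eventually_nhds
  refine fun t ht ↦ hI.subset_of_closure_inter_subset hopen ⟨t₀, ht₀, h⟩ ?_ ht
  rintro t ⟨htc, htI⟩
  have hfr : ∃ᶠ x in 𝓝 t, γ₁ =ᶠ[𝓝 x] γ₂ := mem_closure_iff_frequently.1 htc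
  have heq : γ₁ t = γ₂ t := tendsto_nhds_unique_of_frequently_eq (h₁ t htI).continuousAt
    (h₂ t htI).continuousAt (hfr.mono fun x hx ↦ hx.self_of_nhds)
  obtain ⟨σ, hσ, hu⟩ := (h₁ t htI).same_or_reverse (h₂ t htI) heq
  rcases hσ with rfl | rfl
  · exact eventually_add_iff.1 (by simpa using hu)
  -- Reversed direction: at a nearby point `x` of agreement, `γ₂ x = γ₂ (2 * t - x)`, and local
  -- injectivity forces `x = t`. So `t` itself is a point of agreement.
  · obtain ⟨δ, hδ, hi⟩ := (h₂ t htI).exists_injOn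
    have hu' : ∀ᶠ x in 𝓝 t, γ₁ x = γ₂ (2 * t - x) :=
      eventually_add_iff.1 (hu.mono fun u h ↦ by rw [h]; congr 1; ring)
    have hnear : ∀ᶠ x in 𝓝 t, x ∈ Ioo (t - δ) (t + δ) :=
      isOpen_Ioo.mem_nhds ⟨by linarith, by linarith⟩
    obtain ⟨x, hx1, hx2, hx3⟩ := (hfr.and_eventually (hu'.and hnear)).exists
    have hx : x = 2 * t - x := hi hx3 ⟨by linarith [hx3.2], by linarith [hx3.1]⟩
      (by rw [← hx2, hx1.self_of_nhds])
    have : x = t := by linarith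
    rwa [← this]

end UnitAtlas
end

/-! ### Closed unit speed curves in compact spaces -/

noncomputable section
namespace UnitAtlas

variable {N : Type*} [TopologicalSpace N] {A : UnitAtlas N}

lemma exists_finite_cover [CompactSpace N] (A : UnitAtlas N) {δ : N → ℝ} (hδ : ∀ p, 0 < δ p)
    (hδr : ∀ p, δ p ≤ A.rad p) :
    ∃ s : Finset N, ∀ x, ∃ p ∈ s, ∃ t ∈ Ioo (-δ p) (δ p), A.arc p t = x := by
  have hopen : ∀ p, IsOpen (A.arc p '' Ioo (-δ p) (δ p)) := fun p ↦
    A.isOpen_image p _ (Ioo_subset_Ioo (neg_le_neg (hδr p)) (hδr p)) isOpen_Ioo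
  obtain ⟨s, hs⟩ := isCompact_univ.elim_finite_subcover _ hopen fun p _ ↦
    mem_iUnion.2 ⟨p, 0, ⟨by linarith [hδ p], hδ p⟩, A.arc_zero p⟩
  refine ⟨s, fun x ↦ ?_⟩
  simpa using hs (mem_univ x)

/-- The half-length arcs already have a finite subcover. A point in a half arc can still move by
half the radius in either direction, and the least of these finitely many half radii serves for all
points. -/
lemma exists_uniform [CompactSpace N] (A : UnitAtlas N) :
    ∃ ε > 0, ∀ p, ∃ c : ℝ → N, c 0 = p ∧ ∀ t ∈ Ioo (-ε) ε, A.IsUnitAt c t := by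
  obtain ⟨s, hs⟩ := A.exists_finite_cover (δ := fun p ↦ A.rad p / 2)
    (fun p ↦ half_pos (A.rad_pos p)) (fun p ↦ half_le_self (A.rad_pos p).le)
  classical
  obtain ⟨ε, hε, hεs⟩ : ∃ ε > 0, ∀ p ∈ s, ε ≤ A.rad p / 2 := by
    clear hs
    induction s using Finset.induction_on with
    | empty => exact ⟨1, one_pos, by simp⟩
    | insert a s _ ih =>
      obtain ⟨ε, hε, h⟩ := ih
      refine ⟨min ε (A.rad a / 2), lt_min hε (half_pos (A.rad_pos a)), fun p hp ↦ ?_⟩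
      rcases Finset.mem_insert.1 hp with rfl | hp
      · exact min_le_right _ _
      · exact (min_le_left _ _).trans (h p hp)
  refine ⟨ε, hε, fun x ↦ ?_⟩
  obtain ⟨p, hp, t, ht, rfl⟩ := hs x
  refine ⟨fun u ↦ A.arc p (t + 1 * u), by simp, fun u hu ↦ ?_⟩
  refine (isUnitAt_arc ?_).comp_affine (Or.inl rfl)
  have := hεs p hp
  constructor <;> linarith [hu.1, hu.2, ht.1, ht.2]

/-- Every point lies on a unit speed curve that is defined for all positive times. -/
lemma exists_ray [CompactSpace N] [T2Space N] (A : UnitAtlas N) (p : N) :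
    ∃ γ : ℝ → N, (∀ t > 0, A.IsUnitAt γ t) ∧ ∃ t > 0, γ t = p := by
  obtain ⟨ε, hε, hc⟩ := A.exists_uniform
  set h := ε / 2 with hh
  have hpos : 0 < h := half_pos hε
  let C := {c : ℝ → N // ∀ t ∈ Ioo (-ε) ε, A.IsUnitAt c t}
  -- The next piece is centred at `c h` and is reversed if necessary, so that it continues `c`.
  have step : ∀ c : C, ∃ d : C, ∀ᶠ u in 𝓝 0, d.1 u = c.1 (h + u) := by
    rintro ⟨c, hcu⟩
    obtain ⟨d, hd0, hdu⟩ := hc (c h)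
    obtain ⟨σ, hσ, hu⟩ := (hcu h ⟨by linarith, by linarith⟩).same_or_reverse
      (hdu 0 ⟨by linarith, hε⟩) hd0.symm
    refine ⟨⟨fun u ↦ d (0 + σ * u), fun t ht ↦ (hdu _ ?_).comp_affine hσ⟩, ?_⟩
    · rcases hσ with rfl | rfl <;> constructor <;> linarith [ht.1, ht.2]
    · filter_upwards [hu] with u h1 using h1.symm
  choose nxt hnxt using step
  obtain ⟨c₀, hc₀, hc₀u⟩ := hc p
  let c : ℕ → C := fun k ↦ Nat.rec ⟨c₀, hc₀u⟩ (fun _ d ↦ nxt d) k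
  have hcS : ∀ k, ∀ᶠ u in 𝓝 0, (c (k + 1)).1 u = (c k).1 (h + u) := fun k ↦ hnxt (c k)
  have hcS' : ∀ k, ∀ u ∈ Ioo (-h) h, (c (k + 1)).1 u = (c k).1 (h + u) := by
    intro k u hu
    have h2 : ∀ t ∈ Ioo (-h) h, A.IsUnitAt (fun u ↦ (c k).1 (h + u)) t := fun t ht ↦ by
      have := ((c k).2 (h + 1 * t) ⟨by linarith [ht.1], by linarith [ht.2]⟩).comp_affine
        (Or.inl rfl)
      simpa using this
    exact (eqOn_of_germ isPreconnected_Ioo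
      (fun t ht ↦ (c (k + 1)).2 t ⟨by linarith [ht.1], by linarith [ht.2]⟩) h2
      (t₀ := 0) ⟨by linarith, hpos⟩ (hcS k) u hu).self_of_nhds
  let γ : ℝ → N := fun t ↦ (c ⌊t / h⌋₊).1 (t - ⌊t / h⌋₊ * h)
  -- Piece `k` describes `γ` also on the preceding interval, because consecutive pieces overlap.
  -- This makes every time interior to some window. Negative times above `-h` use piece `0`, as the
  -- natural floor is then `0`.
  have hγ : ∀ (k : ℕ) (t : ℝ), (k - 1) * h < t → t < (k + 1) * h → γ t = (c k).1 (t - k * h) := by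
    intro k t h1 h2
    rcases le_or_gt (k * h) t with h3 | h3
    · have : ⌊t / h⌋₊ = k := by
        rw [Nat.floor_eq_iff (div_nonneg ((by positivity : (0 : ℝ) ≤ k * h).trans h3) hpos.le),
          le_div_iff₀ hpos, div_lt_iff₀ hpos]
        exact ⟨h3, h2⟩
      simp only [γ, this]
    · cases k with
      | zero =>
        have : ⌊t / h⌋₊ = 0 := Nat.floor_of_nonpos
          (div_nonpos_of_nonpos_of_nonneg (by simpa using h3.le) hpos.le)
        simp only [γ, this]
      | succ j =>
        push_cast at h1 h2 h3
        have : ⌊t / h⌋₊ = j := by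
          have h4 : j * h < t := by linarith
          rw [Nat.floor_eq_iff (div_nonneg ((by positivity : (0 : ℝ) ≤ j * h).trans h4.le) hpos.le),
            le_div_iff₀ hpos, div_lt_iff₀ hpos]
          exact ⟨h4.le, h3⟩
        simp only [γ, this]
        rw [hcS' j _ ⟨by push_cast; linarith, by push_cast; linarith⟩]
        push_cast; ring_nf
  have hγu : ∀ t > -h, A.IsUnitAt γ t := by
    intro t ht
    obtain ⟨k, hk1, hk2⟩ : ∃ k : ℕ, (k - 1) * h < t ∧ t < (k + 1) * h := by
      rcases le_or_gt 0 t with h0 | h0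
      · refine ⟨⌊t / h⌋₊, ?_, ?_⟩
        · have := Nat.floor_le (div_nonneg h0 hpos.le)
          rw [le_div_iff₀ hpos] at this
          linarith
        · have := Nat.lt_floor_add_one (t / h)
          rwa [div_lt_iff₀ hpos] at this
      · exact ⟨0, by simpa using ht, by simpa using h0.trans hpos⟩
    refine ((c k).2 (t - k * h) ⟨by linarith, by linarith⟩).congr ?_
    have hn : ∀ᶠ x in 𝓝 t, x ∈ Ioo ((k - 1) * h) ((k + 1) * h) := isOpen_Ioo.mem_nhds ⟨hk1, hk2⟩
    filter_upwards [eventually_add_iff.2 hn] with u hu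
    rw [hγ k _ hu.1 hu.2]
    ring_nf
  -- Shifting by `h` puts `p` at a positive time.
  refine ⟨fun t ↦ γ (-h + 1 * t), fun t ht ↦ (hγu _ (by linarith)).comp_affine (Or.inl rfl), h, hpos, ?_⟩
  have := hγ 0 0 (by simpa using hpos) (by simpa using hpos)
  simpa [hc₀, c] using this

/-- Equal values of a unit speed ray at different times make it periodic. -/
lemma periodic_of_eq [T2Space N] {γ : ℝ → N} (hγ : ∀ t > 0, A.IsUnitAt γ t) {s t : ℝ} (hs : 0 < s)
    (hst : s < t) (h : γ s = γ t) : ∀ u > 0, γ (u + (t - s)) = γ u := by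
  have ht : 0 < t := hs.trans hst
  obtain ⟨σ, hσ, hu⟩ := (hγ s hs).same_or_reverse (hγ t ht) h
  rcases hσ with rfl | rfl
  -- Same direction: `γ` and its translate by `t - s` share a germ at `s`, hence agree at all
  -- positive times.
  · intro u hu0
    refine ((eqOn_of_germ (γ₁ := γ) (γ₂ := fun u ↦ γ ((t - s) + 1 * u)) (isPreconnected_Ioi (a := 0))
      hγ (fun v (hv : 0 < v) ↦ (hγ _ (by linarith)).comp_affine (Or.inl rfl))
      (t₀ := s) hs ?_ u hu0).self_of_nhds.trans ?_).symm
    · refine eventually_add_iff.1 (hu.mono fun v hv ↦ ?_)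
      rw [hv]; congr 1; ring
    · simp only; congr 1; ring
  -- Opposite direction: `γ u = γ (t + s - u)` on `(0, t + s)`, so `γ` would be its own reflection
  -- at the midpoint.
  · have key := (eqOn_of_germ (γ₁ := γ) (γ₂ := fun u ↦ γ ((t + s) + -1 * u))
      (isPreconnected_Ioo (a := 0) (b := t + s))
      (fun v hv ↦ hγ v hv.1) (fun v hv ↦ (hγ _ (by linarith [hv.2])).comp_affine (Or.inr rfl))
      (t₀ := s) ⟨hs, by linarith⟩ ?_ ((s + t) / 2) ⟨by linarith, by linarith⟩)
    · refine ((hγ ((s + t) / 2) (by linarith)).not_reflection ?_).elim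
      filter_upwards [eventually_add_iff.2 key] with v hv
      rw [hv]; congr 1; ring
    · refine eventually_add_iff.1 (hu.mono fun v hv ↦ ?_)
      rw [hv]; congr 1; ring

/-- Pigeonhole: in each of the disjoint time windows `(k + 1/2, k + 3/2)` the ray passes through the
centre of one of finitely many arcs, so two windows share a centre. -/
lemma exists_eq_of_ray [CompactSpace N] [T2Space N] {γ : ℝ → N} (hγ : ∀ t > 0, A.IsUnitAt γ t) :
    ∃ s t, 0 < s ∧ s < t ∧ γ s = γ t := by
  obtain ⟨S, hS⟩ := A.exists_finite_cover (δ := fun p ↦ min (A.rad p / 2) (1 / 2))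
    (fun p ↦ lt_min (half_pos (A.rad_pos p)) (by norm_num))
    (fun p ↦ (min_le_left _ _).trans (half_le_self (A.rad_pos p).le))
  have key : ∀ k : ℕ, ∃ p : S, ∃ t, (k : ℝ) + 1 / 2 < t ∧ t < k + 3 / 2 ∧ γ t = p := by
    intro k
    obtain ⟨p, hp, s, hs, hps⟩ := hS (γ (k + 1))
    have hs1 : s < A.rad p / 2 := hs.2.trans_le (min_le_left _ _)
    have hs2 : s < 1 / 2 := hs.2.trans_le (min_le_right _ _)
    have hs3 : -(A.rad p / 2) < s := (neg_le_neg (min_le_left _ _)).trans_lt hs.1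
    have hs4 : -(1 / 2) < s := (neg_le_neg (min_le_right _ _)).trans_lt hs.1
    have hr := A.rad_pos p
    obtain ⟨σ, hσ, hu⟩ := (hγ (k + 1) (by positivity)).exists_arc (s := s)
      ⟨by linarith, by linarith⟩ hps.symm
    have hk : (0 : ℝ) ≤ k := by positivity
    set δ := min (A.rad p / 2) (1 / 2) with hδ
    have hδ1 : δ ≤ A.rad p / 2 := min_le_left _ _
    have hδ2 : δ ≤ 1 / 2 := min_le_right _ _
    -- At time `k + 1` the ray is at parameter `s` of the arc of `p`. Following the arc for the time
    -- `-σ * s`, which is shorter than `1 / 2`, leads to its centre.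
    have := eqOn_of_germ (A := A) (γ₁ := fun u ↦ γ ((k + 1) + 1 * u)) (γ₂ := fun u ↦ A.arc p (s + σ * u))
      (isPreconnected_Ioo (a := -δ) (b := δ))
      (fun v hv ↦ (hγ _ (by linarith [hv.1])).comp_affine (Or.inl rfl))
      (fun v hv ↦ (isUnitAt_arc (by
        rcases hσ with rfl | rfl <;> constructor <;> linarith [hv.1, hv.2])).comp_affine hσ)
      (t₀ := 0) ⟨by linarith [hs.1, hs.2], by linarith [hs.1, hs.2]⟩
      (by filter_upwards [hu] with u h1; rw [one_mul, h1]) (-σ * s)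
      (by rcases hσ with rfl | rfl <;> constructor <;> linarith [hs.1, hs.2])
    have : γ (k + 1 + 1 * (-σ * s)) = A.arc p (s + σ * (-σ * s)) := this.self_of_nhds
    refine ⟨⟨p, hp⟩, (k + 1) + 1 * (-σ * s), ?_, ?_, ?_⟩
    · rcases hσ with rfl | rfl <;> linarith
    · rcases hσ with rfl | rfl <;> linarith
    · rw [this, show s + σ * (-σ * s) = s - (σ * σ) * s by ring, sign_mul_self hσ, one_mul, sub_self,
        A.arc_zero]
  choose f t ht1 ht2 ht3 using key
  obtain ⟨k, l, hkl, hf⟩ := Finite.exists_ne_map_eq_of_infinite f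
  wlog hlt : k < l generalizing k l
  · exact this l k hkl.symm hf.symm (lt_of_le_of_ne (not_lt.1 hlt) hkl.symm)
  have : (k : ℝ) + 1 ≤ l := by exact_mod_cast hlt
  exact ⟨t k, t l, by have := ht1 k; have : (0 : ℝ) ≤ k := by positivity
                      linarith, by linarith [ht2 k, ht1 l], by rw [ht3, ht3, hf]⟩

/-- Every point of a compact space with a unit atlas lies on a closed unit speed curve that is
injective on its period. -/
theorem exists_closed_curve [CompactSpace N] [T2Space N] (A : UnitAtlas N) (p : N) :
    ∃ (γ : ℝ → N) (T : ℝ), 0 < T ∧ (∀ t, A.IsUnitAt γ t) ∧ p ∈ range γ ∧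
      ∀ s t, γ s = γ t ↔ ∃ n : ℤ, t = s + n * T := by
  obtain ⟨γ, hγ, t₀, ht₀, hp⟩ := A.exists_ray p
  obtain ⟨δ, hδ, hinj⟩ := (hγ 1 one_pos).exists_injOn
  let S := {T | 0 < T ∧ ∀ u > 0, γ (u + T) = γ u}
  have hSδ : ∀ T ∈ S, δ ≤ T := by
    rintro T ⟨hT, hper⟩
    by_contra hlt
    have := hinj (x₁ := 1 + T) (x₂ := 1) ⟨by linarith, by linarith⟩ ⟨by linarith, by linarith⟩
      (hper 1 one_pos)
    linarith
  have hSne : S.Nonempty := by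
    obtain ⟨s, t, hs, hst, h⟩ := exists_eq_of_ray hγ
    exact ⟨t - s, sub_pos.2 hst, periodic_of_eq hγ hs hst h⟩
  have hbdd : BddBelow S := ⟨δ, fun T hT ↦ hSδ T hT⟩
  -- Periods are at least `δ` by local injectivity. A period within `δ` of the infimum is the least
  -- one, because a difference of two periods is again a period.
  obtain ⟨T, hTS, hT⟩ := exists_lt_of_csInf_lt hSne (lt_add_of_pos_right (sInf S) hδ)
  have hmin : ∀ T' ∈ S, T ≤ T' := by
    intro T' hT'
    by_contra! hlt
    have : T - T' ∈ S := by
      have h := periodic_of_eq hγ (s := 1 + T') (t := 1 + T) (by linarith [hT'.1]) (by linarith)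
        (by rw [hT'.2 1 one_pos, hTS.2 1 one_pos])
      exact ⟨sub_pos.2 hlt, fun u hu ↦ by rw [← h u hu]; congr 1; ring⟩
    have := hSδ _ this
    have := csInf_le hbdd hT'
    linarith
  have hT0 : 0 < T := hTS.1
  have hmul : ∀ (n : ℕ) (u : ℝ), 0 < u → γ (u + n * T) = γ u := by
    intro n u hu
    induction n with
    | zero => simp
    | succ n ih =>
      rw [← ih, ← hTS.2 (u + n * T) (by positivity)]
      congr 1; push_cast; ring
  -- the periodic extension
  let β : ℝ → N := fun t ↦ γ (toIocMod hT0 0 t)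
  have hβ : ∀ (t : ℝ) (n : ℤ), 0 < t + n * T → β t = γ (t + n * T) := by
    intro t n hn
    have hm := toIocMod_mem_Ioc hT0 0 t
    have hd : toIocMod hT0 0 t = t - toIocDiv hT0 0 t * T := by
      rw [toIocMod]; simp
    set m := toIocDiv hT0 0 t
    have hm0 : 0 < t - m * T := hd ▸ hm.1
    have hmT : t - m * T ≤ T := by simpa [hd] using hm.2
    -- From `t - m * T ≤ T` and `0 < t + n * T` follows `-T < (n + m) * T`.
    have hle : 0 ≤ n + m := by
      have : (-1 : ℝ) < ((n + m : ℤ) : ℝ) := by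
        push_cast
        by_contra! hlt
        nlinarith
      have : (-1 : ℤ) < n + m := by exact_mod_cast this
      omega
    obtain ⟨k, hk⟩ := Int.eq_ofNat_of_zero_le hle
    have hk' : (n : ℝ) + m = k := by exact_mod_cast hk
    simp only [β, hd]
    rw [← hmul k _ hm0, ← hk']
    congr 1; ring
  have hbig : ∀ t : ℝ, ∃ n : ℤ, 0 < t + n * T := by
    intro t
    obtain ⟨n, hn⟩ := exists_nat_gt (-t / T)
    rw [div_lt_iff₀ hT0] at hn
    exact ⟨n, by push_cast; linarith⟩
  refine ⟨β, T, hT0, fun t ↦ ?_, ⟨t₀, ?_⟩, fun s t ↦ ⟨fun h ↦ ?_, ?_⟩⟩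
  · obtain ⟨n, hn⟩ := hbig t
    refine (hγ _ hn).congr ?_
    have hn' : ∀ᶠ x in 𝓝 t, 0 < x + n * T :=
      (by fun_prop : Continuous fun x : ℝ ↦ x + n * T).continuousAt.eventually (lt_mem_nhds hn)
    filter_upwards [eventually_add_iff.2 hn'] with u hu
    rw [hβ _ n hu]; congr 1; ring
  · rw [hβ t₀ 0 (by simpa using ht₀), ← hp]; simp
  · have key : ∀ a b : ℝ, 0 < a → 0 < b → a ≤ T → b ≤ T → γ a = γ b → a = b := by
      intro a b ha hb haT hbT hab
      by_contra hne
      wlog hlt : a < b generalizing a b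
      · exact this b a hb ha hbT haT hab.symm (Ne.symm hne) (lt_of_le_of_ne (not_lt.1 hlt) (Ne.symm hne))
      have := hmin (b - a) ⟨sub_pos.2 hlt, periodic_of_eq hγ ha hlt hab⟩
      linarith
    have hs := toIocMod_mem_Ioc hT0 0 s
    have ht := toIocMod_mem_Ioc hT0 0 t
    have := key _ _ hs.1 ht.1 (by simpa using hs.2) (by simpa using ht.2) h
    refine ⟨toIocDiv hT0 0 t - toIocDiv hT0 0 s, ?_⟩
    simp only [toIocMod, zsmul_eq_mul] at this
    push_cast; linarith
  · rintro ⟨n, rfl⟩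
    obtain ⟨m, hm⟩ := hbig s
    rw [hβ s m hm, hβ (s + n * T) (m - n) (by push_cast; linarith)]
    congr 1; push_cast; ring

end UnitAtlas
end

/-! ### Periodic curves as embedded circles -/

noncomputable section

/-- The splitting of the space into the first coordinate axis and the plane of the other two. -/
def axisEquiv : (EuclideanSpace ℝ (Fin 1) × EuclideanSpace ℝ (Fin 2)) ≃L[ℝ]
    EuclideanSpace ℝ (Fin 3) :=
  LinearEquiv.toContinuousLinearEquiv
    { toFun := fun x ↦ !₂[x.1 0, x.2 0, x.2 1]
      map_add' := fun x y ↦ by ext i; fin_cases i <;> simp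
      map_smul' := fun c x ↦ by ext i; fin_cases i <;> simp
      invFun := fun y ↦ (!₂[y 0], !₂[y 1, y 2])
      left_inv := fun x ↦ by
        refine Prod.ext ?_ ?_
        · ext i; fin_cases i; simp
        · ext i; fin_cases i <;> simp
      right_inv := fun x ↦ by ext i; fin_cases i <;> simp }

lemma axisEquiv_apply_zero (x : EuclideanSpace ℝ (Fin 1)) : axisEquiv (x, 0) = !₂[x 0, 0, 0] := by
  change !₂[x 0, (0 : EuclideanSpace ℝ (Fin 2)) 0, (0 : EuclideanSpace ℝ (Fin 2)) 1] = _
  simp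

/-- The chart of the circle around `Circle.exp θ` given by a multiple of the angle. -/
def circleAngleChart (θ k δ : ℝ) (hk : k ≠ 0) (hδ : δ ≤ Real.pi) :
    OpenPartialHomeomorph Circle (EuclideanSpace ℝ (Fin 1)) where
  toFun z := !₂[k * Complex.arg ((Circle.exp (-θ) * z : Circle) : ℂ)]
  invFun x := Circle.exp (θ + x 0 / k)
  source := (fun z ↦ Circle.exp (-θ) * z) ⁻¹' (Circle.exp '' Ioo (-δ) δ)
  target := {x | x 0 / k ∈ Ioo (-δ) δ}
  map_source' := by
    rintro z ⟨a, ha, haz⟩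
    simp only at haz
    rw [mem_ofPred_eq, ← haz, Circle.arg_exp (by linarith [ha.1]) (by linarith [ha.2])]
    simpa [hk] using ha
  map_target' := by
    intro x hx
    refine ⟨x 0 / k, hx, ?_⟩
    simp only
    rw [← Circle.exp_add]; congr 1; ring
  left_inv' := by
    rintro z ⟨a, ha, haz⟩
    simp only at haz
    simp only [← haz, Circle.arg_exp (show -Real.pi < a by linarith [ha.1])
      (show a ≤ Real.pi by linarith [ha.2])]
    have : (!₂[k * a] : EuclideanSpace ℝ (Fin 1)) 0 / k = a := by simp [hk]
    rw [this, Circle.exp_add, haz, ← mul_assoc, ← Circle.exp_add]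
    simp
  right_inv' := by
    intro x hx
    have h1 : -θ + (θ + x 0 / k) = x 0 / k := by ring
    simp only [mem_ofPred_eq] at hx
    rw [← Circle.exp_add, h1, Circle.arg_exp (by linarith [hx.1]) (by linarith [hx.2])]
    ext i; fin_cases i; simp; field_simp
  open_source := ((isLocalHomeomorph_circleExp.isOpenMap _ isOpen_Ioo)).preimage (by fun_prop)
  open_target := isOpen_Ioo.preimage (by fun_prop)
  continuousOn_toFun := by
    rintro z ⟨a, ha, haz⟩
    have hs : ((Circle.exp (-θ) * z : Circle) : ℂ) ∈ Complex.slitPlane := by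
      have haz' : Circle.exp (-θ) * z = Circle.exp a := haz.symm
      rw [haz', Complex.mem_slitPlane_iff_arg,
        Circle.arg_exp (by linarith [ha.1]) (by linarith [ha.2])]
      exact ⟨by linarith [ha.2], Circle.coe_ne_zero _⟩
    have h1 : ContinuousAt (fun z : Circle ↦ Complex.arg ((Circle.exp (-θ) * z : Circle) : ℂ)) z :=
      ContinuousAt.comp (f := fun z : Circle ↦ ((Circle.exp (-θ) * z : Circle) : ℂ))
        (Complex.continuousAt_arg hs) (by fun_prop)
    refine ContinuousAt.continuousWithinAt ?_
    fun_prop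
  continuousOn_invFun := by fun_prop

/-- The angle is the imaginary part of the complex logarithm, which is smooth on the slit plane. The
inverse is the exponential of an affine function. -/
lemma circleAngleChart_mem_maximalAtlas (θ k δ : ℝ) (hk : k ≠ 0) (hδ : δ ≤ Real.pi) (r : ℕ∞) :
    circleAngleChart θ k δ hk hδ ∈ IsManifold.maximalAtlas (𝓡 1) r Circle := by
  have : IsManifold (𝓡 1) r Circle := IsManifold.of_le (n := ω) le_top
  have : Fact (Module.finrank ℝ ℂ = 1 + 1) := ⟨by simp⟩
  refine OpenPartialHomeomorph.mem_maximalAtlas_of_contMDiffOn _ ?_ ?_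
  · rintro z ⟨a, ha, haz⟩
    have hs : (Circle.exp (-θ) : ℂ) * (z : ℂ) ∈ Complex.slitPlane := by
      have haz' : Circle.exp (-θ) * z = Circle.exp a := haz.symm
      rw [← Circle.coe_mul, haz', Complex.mem_slitPlane_iff_arg,
        Circle.arg_exp (by linarith [ha.1]) (by linarith [ha.2])]
      exact ⟨by linarith [ha.2], Circle.coe_ne_zero _⟩
    have h1 : ContMDiffAt (𝓡 1) 𝓘(ℝ, ℂ) r (fun z : Circle ↦ (z : ℂ)) z :=
      (contMDiff_coe_sphere (E := ℂ) (n := 1)).contMDiffAt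
    have h2 : ContDiffAt ℝ r (fun w : ℂ ↦
        (!₂[k * (Complex.log ((Circle.exp (-θ) : ℂ) * w)).im] : EuclideanSpace ℝ (Fin 1))) (z : ℂ) := by
      rw [contDiffAt_euclidean]
      intro i
      fin_cases i
      simp only [Fin.isValue, Fin.zero_eta, Matrix.cons_val_zero]
      refine contDiffAt_const.mul ?_
      refine ContDiffAt.comp (g := Complex.im) (z : ℂ) Complex.imCLM.contDiff.contDiffAt ?_
      exact ((Complex.contDiffAt_log hs).restrict_scalars ℝ).comp (z : ℂ)
        (f := fun w : ℂ ↦ (Circle.exp (-θ) : ℂ) * w) (by fun_prop)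
    have h3 := h2.contMDiffAt.comp z h1
    refine (h3.congr_of_eventuallyEq (Filter.Eventually.of_forall fun w ↦ ?_)).contMDiffWithinAt
    simp only [circleAngleChart, Complex.log_im, Function.comp, Circle.coe_mul]; rfl
  · refine ContMDiff.contMDiffOn ?_
    have h1 : ContDiff ℝ r (fun x : EuclideanSpace ℝ (Fin 1) ↦ θ + x 0 / k) := by fun_prop
    exact contMDiff_circleExp.comp h1.contMDiff

variable {M : Type*} [TopologicalSpace M] [T2Space M]
  [ChartedSpace (EuclideanSpace ℝ (Fin 3)) M]

/-- A closed curve that is a straight line in suitable charts is a `C^r` embedded circle. -/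
theorem exists_isSmoothEmbedding_of_closed_curve {r : ℕ∞} {γ : ℝ → M} {T : ℝ} (hT : 0 < T)
    (hper : ∀ s t, γ s = γ t ↔ ∃ n : ℤ, t = s + n * T)
    (hstr : ∀ t, ∃ ψ ∈ IsManifold.maximalAtlas (𝓡 3) r M, γ t ∈ ψ.source ∧
      ∃ σ : ℝ, (σ = 1 ∨ σ = -1) ∧
        ∀ᶠ u in 𝓝 0, γ (t + u) ∈ ψ.source ∧ ψ (γ (t + u)) = !₂[σ * u, 0, 0]) :
    ∃ f : Circle → M, IsSmoothEmbedding (𝓡 1) (𝓡 3) r f ∧ range f = range γ := by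
  have hpi := Real.pi_pos
  have hγc : Continuous γ := by
    refine continuous_iff_continuousAt.2 fun t ↦ ?_
    obtain ⟨ψ, -, hψ, σ, -, hu⟩ := hstr t
    have h0 : ψ (γ t) = !₂[0, 0, 0] := by simpa using hu.self_of_nhds.2
    have h1 : ContinuousAt ψ.symm !₂[0, 0, 0] := by
      rw [← h0]; exact ψ.symm.continuousAt (ψ.map_source hψ)
    have h2 : Filter.Tendsto (fun u : ℝ ↦ (!₂[σ * u, 0, 0] : EuclideanSpace ℝ (Fin 3))) (𝓝 0)
        (𝓝 !₂[0, 0, 0]) := by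
      have : Continuous fun u : ℝ ↦ (!₂[σ * u, 0, 0] : EuclideanSpace ℝ (Fin 3)) := by fun_prop
      simpa using this.tendsto 0
    rw [ContinuousAt, ← map_add_left_nhds_zero t, Filter.tendsto_map'_iff]
    have h3 := h1.tendsto.comp h2
    rw [← h0, ψ.left_inv hψ] at h3
    refine h3.congr' (hu.mono fun u h ↦ ?_)
    simp only [Function.comp, ← h.2, ψ.left_inv h.1]
  -- The argument of `Circle.exp θ` differs from `θ` by a multiple of `2π`, hence the times differ
  -- by a multiple of `T`.
  have hexp : ∀ θ, γ (T / (2 * Real.pi) * Complex.arg (Circle.exp θ)) =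
      γ (T / (2 * Real.pi) * θ) := by
    intro θ
    rw [hper]
    obtain ⟨m, hm⟩ := Circle.exp_eq_exp.1 (Circle.exp_arg (Circle.exp θ))
    refine ⟨-m, ?_⟩
    rw [hm]; push_cast; field_simp; ring
  let f : Circle → M := fun z ↦ γ (T / (2 * Real.pi) * Complex.arg z)
  have hf : ∀ θ, f (Circle.exp θ) = γ (T / (2 * Real.pi) * θ) := hexp
  have hfc : Continuous f := by
    refine continuous_iff_continuousAt.2 fun z ↦ ?_
    rw [← Circle.exp_arg z, ContinuousAt, ← isLocalHomeomorph_circleExp.map_nhds_eq,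
      Filter.tendsto_map'_iff, hf]
    have : (f ∘ Circle.exp) = fun θ ↦ γ (T / (2 * Real.pi) * θ) := funext hf
    rw [this]
    exact (hγc.comp (by fun_prop : Continuous fun θ : ℝ ↦ T / (2 * Real.pi) * θ)).tendsto _
  have hfi : Function.Injective f := by
    intro z w h
    rw [← Circle.exp_arg z, ← Circle.exp_arg w, hf, hf, hper] at h
    obtain ⟨n, hn⟩ := h
    rw [← Circle.exp_arg z, ← Circle.exp_arg w, Circle.exp_eq_exp]
    refine ⟨-n, ?_⟩
    field_simp at hn
    push_cast; linarith
  refine ⟨f, ⟨?_, (hfc.isClosedEmbedding hfi).isEmbedding⟩, ?_⟩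
  · refine ⟨EuclideanSpace ℝ (Fin 2), inferInstance, inferInstance, fun z ↦ ?_⟩
    obtain ⟨θ, rfl⟩ : ∃ θ, Circle.exp θ = z := ⟨_, Circle.exp_arg z⟩
    obtain ⟨ψ, hψ, hψs, σ, hσ, hu⟩ := hstr (T / (2 * Real.pi) * θ)
    obtain ⟨ε, hε, he⟩ := Metric.eventually_nhds_iff.1 hu
    have hσ0 : σ ≠ 0 := by rcases hσ with rfl | rfl <;> norm_num
    have hσσ : σ * σ = 1 := UnitAtlas.sign_mul_self hσ
    have hk : σ * (T / (2 * Real.pi)) ≠ 0 := by positivity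
    -- With this scale the circle chart carries `x` to the time `t + σ * x 0`, whose image in `ψ` is
    -- `(x 0, 0, 0)` since `σ * σ = 1`. In `δ`, the bound `π` keeps the angle a chart and `ε / |k|`
    -- keeps the curve where it is straight.
    set k := σ * (T / (2 * Real.pi)) with hkd
    set δ := min Real.pi (ε / |k|) with hδ
    have hk' : 0 < |k| := abs_pos.2 hk
    have hδ0 : 0 < δ := lt_min hpi (by positivity)
    refine IsImmersionAtOfComplement.mk_of_continuousAt hfc.continuousAt axisEquiv
      (circleAngleChart θ k δ hk (min_le_left _ _)) ψ ?_ (by rwa [hf])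
      (circleAngleChart_mem_maximalAtlas _ _ _ _ _ _) hψ ?_
    · exact ⟨0, ⟨by linarith, hδ0⟩, by simp⟩
    · intro x hx
      have hx' : x 0 / k ∈ Ioo (-δ) δ := by
        simpa [circleAngleChart] using hx
      have hs : ((circleAngleChart θ k δ hk (min_le_left _ _)).extend (𝓡 1)).symm x =
        Circle.exp (θ + x 0 / k) := by simp [circleAngleChart]
      have hx2 : |x 0| < ε := by
        have := abs_lt.2 hx'
        rw [abs_div, div_lt_iff₀ hk'] at this
        refine this.trans_le ?_
        rw [← le_div_iff₀ hk']
        exact min_le_right _ _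
      have h2 : T / (2 * Real.pi) * (θ + x 0 / k) = T / (2 * Real.pi) * θ + σ * x 0 := by
        rw [hkd, mul_add]
        congr 1
        field_simp
        rw [sq, hσσ, mul_one]
      have h3 := @he (σ * x 0) (by
        rw [Real.dist_eq, sub_zero, abs_mul]
        rcases hσ with rfl | rfl <;> simpa using hx2)
      simp only [Function.comp, hs, hf, h2, axisEquiv_apply_zero]
      simp only [OpenPartialHomeomorph.extend_coe, modelWithCornersSelf_coe, Function.comp, id, h3.2,
        ← mul_assoc, hσσ, one_mul]
  · ext x
    constructor
    · rintro ⟨z, rfl⟩; exact mem_range_self _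
    · rintro ⟨t, rfl⟩
      refine ⟨Circle.exp (2 * Real.pi / T * t), ?_⟩
      rw [hf]; congr 1; field_simp

end

/-! ### Changes of chart and arc length -/

noncomputable section

variable {M : Type*} [TopologicalSpace M] [ChartedSpace (EuclideanSpace ℝ (Fin 3)) M]

lemma coe_le_infty (r : ℕ∞) : (r : ℕ∞ω) ≤ ∞ := by
  exact_mod_cast (le_top : r ≤ ⊤)

lemma isManifold_of_smooth [IsManifold (𝓡 3) ∞ M] (r : ℕ∞) : IsManifold (𝓡 3) r M :=
  IsManifold.of_le (coe_le_infty r)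

/-- Postcomposition of a chart with a map whose derivative is invertible at a point. -/
lemma exists_chart_postcomp [IsManifold (𝓡 3) ∞ M] {r : ℕ∞} (hr : 1 ≤ r)
    {ψ : OpenPartialHomeomorph M (EuclideanSpace ℝ (Fin 3))}
    (hψ : ψ ∈ IsManifold.maximalAtlas (𝓡 3) r M) {p : M} (hp : p ∈ ψ.source)
    {R : EuclideanSpace ℝ (Fin 3) → EuclideanSpace ℝ (Fin 3)} {W : Set (EuclideanSpace ℝ (Fin 3))}
    (hW : IsOpen W) (hpW : ψ p ∈ W) (hR : ContDiffOn ℝ r R W)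
    (R' : EuclideanSpace ℝ (Fin 3) ≃L[ℝ] EuclideanSpace ℝ (Fin 3))
    (hR' : HasFDerivAt R (R' : EuclideanSpace ℝ (Fin 3) →L[ℝ] EuclideanSpace ℝ (Fin 3)) (ψ p)) :
    ∃ φ ∈ IsManifold.maximalAtlas (𝓡 3) r M, p ∈ φ.source ∧ φ.source ⊆ ψ.source ∧
      ∀ q ∈ φ.source, ψ q ∈ W ∧ φ q = R (ψ q) := by
  have := isManifold_of_smooth (M := M) r
  have hr0 : (r : ℕ∞ω) ≠ 0 := by
    have : r ≠ 0 := by rintro rfl; simp at hr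
    exact_mod_cast this
  have hr1 : (1 : ℕ∞ω) ≤ r := by exact_mod_cast hr
  have hRat : ∀ x ∈ W, ContDiffAt ℝ r R x := fun x hx ↦ hR.contDiffAt (hW.mem_nhds hx)
  let Φ := (hRat _ hpW).toOpenPartialHomeomorph R hR' hr0
  have hΦ : ∀ x, Φ x = R x := fun x ↦ rfl
  have hcont : ContinuousOn (fderiv ℝ R) W := (hR.continuousOn_fderiv_of_isOpen hW hr1)
  -- Restricting to the open set where the derivative is invertible makes the local inverse `C^r` at
  -- every point of its domain, not only at the image of `ψ p`.
  set S := W ∩ fderiv ℝ R ⁻¹' range ((↑) : (EuclideanSpace ℝ (Fin 3) ≃L[ℝ] EuclideanSpace ℝ (Fin 3)) → _)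
    with hS
  have hSo : IsOpen S := hcont.isOpen_inter_preimage hW ContinuousLinearEquiv.isOpen
  let Θ := Φ.restrOpen S hSo
  have hΘ : ∀ x, Θ x = R x := fun x ↦ rfl
  have hΘs : Θ.source = Φ.source ∩ S := rfl
  have hpΘ : ψ p ∈ Θ.source := by
    rw [hΘs]
    exact ⟨(hRat _ hpW).mem_toOpenPartialHomeomorph_source hR' hr0, hpW, R', hR'.fderiv.symm⟩
  have h1 : ContDiffOn ℝ r Θ Θ.source := fun x hx ↦ (hRat x hx.2.1).contDiffWithinAt
  have h2 : ContDiffOn ℝ r Θ.symm Θ.target := by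
    intro y hy
    obtain ⟨-, hxW, A, hA⟩ := Θ.map_target hy
    refine ContDiffAt.contDiffWithinAt (Θ.contDiffAt_symm (f₀' := A) hy ?_ (hRat _ hxW))
    rw [hA]
    exact ((hRat _ hxW).differentiableAt hr0).hasFDerivAt
  refine ⟨ψ.trans Θ, OpenPartialHomeomorph.mem_maximalAtlas_of_contMDiffOn _ ?_ ?_, ?_, ?_, ?_⟩
  · rw [OpenPartialHomeomorph.trans_source]
    exact h1.contMDiffOn.comp ((contMDiffOn_of_mem_maximalAtlas hψ).mono inter_subset_left)
      (fun x hx ↦ hx.2)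
  · rw [OpenPartialHomeomorph.trans_target]
    exact (contMDiffOn_symm_of_mem_maximalAtlas hψ).comp (h2.contMDiffOn.mono inter_subset_left)
      (fun x hx ↦ hx.2)
  · rw [OpenPartialHomeomorph.trans_source]; exact ⟨hp, hpΘ⟩
  · rw [OpenPartialHomeomorph.trans_source]; exact inter_subset_left
  · intro q hq
    rw [OpenPartialHomeomorph.trans_source] at hq
    exact ⟨hq.2.2.1, rfl⟩

/-- The expression in a `C^r` chart of a smooth immersive map is an immersion. -/
lemma fderiv_comp_symm_injective [IsManifold (𝓡 3) ∞ M] {r : ℕ∞} (hr : 1 ≤ r) {n : ℕ}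
    {e : M → EuclideanSpace ℝ (Fin n)} (he : ContMDiff (𝓡 3) (𝓡 n) ∞ e)
    (hei : ∀ x : M, Function.Injective (mfderiv (𝓡 3) (𝓡 n) e x))
    {ψ : OpenPartialHomeomorph M (EuclideanSpace ℝ (Fin 3))}
    (hψ : ψ ∈ IsManifold.maximalAtlas (𝓡 3) r M) {x : EuclideanSpace ℝ (Fin 3)}
    (hx : x ∈ ψ.target) : Function.Injective (fderiv ℝ (e ∘ ψ.symm) x) := by
  have := isManifold_of_smooth (M := M) r
  have hr0 : (r : ℕ∞ω) ≠ 0 := by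
    have : r ≠ 0 := by rintro rfl; simp at hr
    exact_mod_cast this
  have h1 : MDifferentiableAt (𝓡 3) (𝓡 3) ψ.symm x :=
    (contMDiffAt_symm_of_mem_maximalAtlas hψ hx).mdifferentiableAt hr0
  have h2 : MDifferentiableAt (𝓡 3) (𝓡 3) ψ (ψ.symm x) :=
    (contMDiffAt_of_mem_maximalAtlas hψ (ψ.map_target hx)).mdifferentiableAt hr0
  have h3 : MDifferentiableAt (𝓡 3) (𝓡 n) e (ψ.symm x) := he.mdifferentiableAt (by simp)
  have h4 : Function.Injective (mfderiv (𝓡 3) (𝓡 3) ψ.symm x) := by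
    have h5 : mfderiv (𝓡 3) (𝓡 3) (ψ ∘ ψ.symm) x = mfderiv (𝓡 3) (𝓡 3) id x := by
      refine Filter.EventuallyEq.mfderiv_eq ?_
      filter_upwards [ψ.open_target.mem_nhds hx] with y hy using ψ.right_inv hy
    rw [mfderiv_comp x h2 h1, mfderiv_id] at h5
    refine Function.LeftInverse.injective (g := mfderiv (𝓡 3) (𝓡 3) ψ (ψ.symm x)) fun v ↦ ?_
    exact congrArg (fun f ↦ f v) h5
  rw [← mfderiv_eq_fderiv, mfderiv_comp x h3 h1]
  exact (hei _).comp h4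

lemma contDiffOn_comp_symm [IsManifold (𝓡 3) ∞ M] {r : ℕ∞} {n : ℕ}
    {e : M → EuclideanSpace ℝ (Fin n)} (he : ContMDiff (𝓡 3) (𝓡 n) ∞ e)
    {ψ : OpenPartialHomeomorph M (EuclideanSpace ℝ (Fin 3))}
    (hψ : ψ ∈ IsManifold.maximalAtlas (𝓡 3) r M) : ContDiffOn ℝ r (e ∘ ψ.symm) ψ.target := by
  have := isManifold_of_smooth (M := M) r
  exact ((he.of_le (coe_le_infty r)).comp_contMDiffOn
    (contMDiffOn_symm_of_mem_maximalAtlas hψ)).contDiffOn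

/-- The line `t ↦ (t, 0, 0)`. -/
def axis (t : ℝ) : EuclideanSpace ℝ (Fin 3) := !₂[t, 0, 0]

lemma contDiff_axis {n : ℕ∞ω} : ContDiff ℝ n axis := by
  unfold axis
  rw [contDiff_euclidean]
  intro i; fin_cases i <;> simp <;> fun_prop

lemma hasDerivAt_axis (t : ℝ) : HasDerivAt axis (axis 1) t := by
  have h : axis = fun t ↦ t • axis 1 := by
    ext t i; fin_cases i <;> simp [axis]
  rw [h]
  simpa [axis] using (hasDerivAt_id t).smul_const (axis 1)

lemma eq_axis {x : EuclideanSpace ℝ (Fin 3)} (h1 : x 1 = 0) (h2 : x 2 = 0) : x = axis (x 0) := by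
  ext i; fin_cases i <;> simp [axis, h1, h2]

/-- In the chart `ψ` the set `L` is the first coordinate axis. -/
def IsStraight (ψ : OpenPartialHomeomorph M (EuclideanSpace ℝ (Fin 3))) (L : Set M) : Prop :=
  ∀ q ∈ ψ.source, q ∈ L ↔ ψ q 1 = 0 ∧ ψ q 2 = 0

/-- The speed is `C^(r-1)` because the norm is smooth away from zero, so its primitive is `C^r`.
Writing `r = m + 1` covers `r = ∞` too. -/
lemma exists_arclength_function {r : ℕ∞} (hr : 1 ≤ r) {n : ℕ} {c : ℝ → EuclideanSpace ℝ (Fin n)}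
    {a : ℝ} {J : Set ℝ} (hJ : IsOpen J) (hJc : J.OrdConnected) (ha : a ∈ J)
    (hc : ContDiffOn ℝ r c J) (hc0 : ∀ t ∈ J, deriv c t ≠ 0) :
    ∃ s : ℝ → ℝ, s a = 0 ∧ ContDiffOn ℝ r s J ∧ ∀ t ∈ J, HasDerivAt s ‖deriv c t‖ t := by
  obtain ⟨m, rfl⟩ : ∃ m : ℕ∞, r = m + 1 := ⟨r - 1, (tsub_add_cancel_of_le hr).symm⟩
  rw [show ((m + 1 : ℕ∞) : ℕ∞ω) = (m : ℕ∞ω) + 1 by push_cast; rfl] at hc ⊢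
  have hd := ((contDiffOn_succ_iff_deriv_of_isOpen hJ).1 hc).2.2
  have hv : ContDiffOn ℝ m (fun t ↦ ‖deriv c t‖) J := hd.norm ℝ hc0
  have hder : ∀ t ∈ J, HasDerivAt (fun x ↦ ∫ τ in a..x, ‖deriv c τ‖) ‖deriv c t‖ t := by
    intro t ht
    refine intervalIntegral.integral_hasDerivAt_right ?_ ?_ (hv.continuousOn.continuousAt (hJ.mem_nhds ht))
    · exact (hv.continuousOn.mono (hJc.uIcc_subset ha ht)).intervalIntegrable
    · exact hv.continuousOn.stronglyMeasurableAtFilter hJ t ht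
  refine ⟨_, intervalIntegral.integral_same, ?_, hder⟩
  rw [contDiffOn_succ_iff_deriv_of_isOpen hJ]
  refine ⟨fun t ht ↦ (hder t ht).differentiableAt.differentiableWithinAt, by simp, ?_⟩
  exact hv.congr fun t ht ↦ (hder t ht).deriv

/-- Straight charts can be reparametrized such that the axis is parametrized by the arc length of
its image under `e`. -/
lemma exists_unit_chart [IsManifold (𝓡 3) ∞ M] {r : ℕ∞} (hr : 1 ≤ r) {n : ℕ}
    {e : M → EuclideanSpace ℝ (Fin n)} (he : ContMDiff (𝓡 3) (𝓡 n) ∞ e)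
    (hei : ∀ x : M, Function.Injective (mfderiv (𝓡 3) (𝓡 n) e x)) {L : Set M} {p : M} (hpL : p ∈ L)
    {ψ : OpenPartialHomeomorph M (EuclideanSpace ℝ (Fin 3))}
    (hψ : ψ ∈ IsManifold.maximalAtlas (𝓡 3) r M) (hp : p ∈ ψ.source) (hL : IsStraight ψ L) :
    ∃ φ ∈ IsManifold.maximalAtlas (𝓡 3) r M, p ∈ φ.source ∧ φ p = axis 0 ∧ IsStraight φ L ∧
      ∃ ε > 0, ∀ t ∈ Ioo (-ε) ε, axis t ∈ φ.target ∧
        ∃ c', ‖c'‖ = 1 ∧ HasDerivAt (fun t ↦ e (φ.symm (axis t))) c' t := by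
  have hr0 : (r : ℕ∞ω) ≠ 0 := by
    have : r ≠ 0 := by rintro rfl; simp at hr
    exact_mod_cast this
  have hax : ψ p = axis (ψ p 0) := eq_axis ((hL p hp).1 hpL).1 ((hL p hp).1 hpL).2
  set a := ψ p 0 with ha
  have haT : axis a ∈ ψ.target := hax ▸ ψ.map_source hp
  obtain ⟨δ, hδ, hδT⟩ := Metric.isOpen_iff.1
    (ψ.open_target.preimage (contDiff_axis (n := 0)).continuous) a haT
  rw [Real.ball_eq_Ioo] at hδT
  set J := Ioo (a - δ) (a + δ) with hJ
  have hJT : ∀ t ∈ J, axis t ∈ ψ.target := hδT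
  have haJ : a ∈ J := ⟨by linarith, by linarith⟩
  set c : ℝ → EuclideanSpace ℝ (Fin n) := fun t ↦ e (ψ.symm (axis t)) with hc
  have hE := contDiffOn_comp_symm he hψ
  have hcC : ContDiffOn ℝ r c J := hE.comp contDiff_axis.contDiffOn hJT
  have hcd : ∀ t ∈ J, deriv c t ≠ 0 := by
    intro t ht h0
    have h1 : HasDerivAt c (fderiv ℝ (e ∘ ψ.symm) (axis t) (axis 1)) t :=
      (((hE.contDiffAt (ψ.open_target.mem_nhds (hJT t ht))).differentiableAt hr0).hasFDerivAt).comp_hasDerivAt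
        t (hasDerivAt_axis t)
    rw [h1.deriv] at h0
    have h2 := fderiv_comp_symm_injective hr he hei hψ (hJT t ht) (h0.trans (map_zero _).symm)
    have h3 := congrArg (fun x : EuclideanSpace ℝ (Fin 3) ↦ x 0) h2
    simp [axis] at h3
  obtain ⟨s, hsa, hsC, hsd⟩ := exists_arclength_function hr isOpen_Ioo ordConnected_Ioo haJ hcC hcd
  have hv : ‖deriv c a‖ ≠ 0 := norm_ne_zero_iff.2 (hcd a haJ)
  -- Only the coordinate along the axis changes, so the new chart is still straight for `L`.
  let R : EuclideanSpace ℝ (Fin 3) → EuclideanSpace ℝ (Fin 3) := fun x ↦ !₂[s (x 0), x 1, x 2]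
  let R' : EuclideanSpace ℝ (Fin 3) ≃L[ℝ] EuclideanSpace ℝ (Fin 3) :=
    LinearEquiv.toContinuousLinearEquiv
    { toFun := fun x ↦ !₂[‖deriv c a‖ * x 0, x 1, x 2]
      map_add' := fun x y ↦ by ext i; fin_cases i <;> simp [mul_add]
      map_smul' := fun c x ↦ by ext i; fin_cases i <;> simp [mul_left_comm]
      invFun := fun y ↦ !₂[‖deriv c a‖⁻¹ * y 0, y 1, y 2]
      left_inv := fun x ↦ by ext i; fin_cases i <;> simp [hv]
      right_inv := fun x ↦ by ext i; fin_cases i <;> simp [hv] }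
  have hR' : HasFDerivAt R (R' : EuclideanSpace ℝ (Fin 3) →L[ℝ] EuclideanSpace ℝ (Fin 3)) (ψ p) := by
    rw [← hasFDerivWithinAt_univ, hasFDerivWithinAt_euclidean]
    have hpr : ∀ i : Fin 3, HasFDerivAt (fun x : EuclideanSpace ℝ (Fin 3) ↦ x i)
        (EuclideanSpace.proj i : EuclideanSpace ℝ (Fin 3) →L[ℝ] ℝ) (ψ p) :=
      fun i ↦ (EuclideanSpace.proj i : EuclideanSpace ℝ (Fin 3) →L[ℝ] ℝ).hasFDerivAt
    intro i
    rw [hasFDerivWithinAt_univ]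
    fin_cases i
    · exact ((hsd a haJ).comp_hasFDerivAt (ψ p) (hpr 0))
    · exact hpr 1
    · exact hpr 2
  have hWo : IsOpen {x : EuclideanSpace ℝ (Fin 3) | x 0 ∈ J} := isOpen_Ioo.preimage (by fun_prop)
  have hRC : ContDiffOn ℝ r R {x : EuclideanSpace ℝ (Fin 3) | x 0 ∈ J} := by
    rw [contDiffOn_euclidean]
    intro i
    fin_cases i
    · exact hsC.comp (f := fun x : EuclideanSpace ℝ (Fin 3) ↦ x 0) (by fun_prop) (fun x hx ↦ hx)
    · exact (by fun_prop : ContDiff ℝ r fun x : EuclideanSpace ℝ (Fin 3) ↦ x 1).contDiffOn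
    · exact (by fun_prop : ContDiff ℝ r fun x : EuclideanSpace ℝ (Fin 3) ↦ x 2).contDiffOn
  obtain ⟨φ, hφ, hpφ, hφψ, hφR⟩ := exists_chart_postcomp hr hψ hp hWo haJ hRC R' hR'
  have hR0 : ∀ q ∈ φ.source, φ q 0 = s (ψ q 0) := fun q hq ↦ by rw [(hφR q hq).2]; rfl
  have hR1 : ∀ q ∈ φ.source, φ q 1 = ψ q 1 := fun q hq ↦ by rw [(hφR q hq).2]; rfl
  have hR2 : ∀ q ∈ φ.source, φ q 2 = ψ q 2 := fun q hq ↦ by rw [(hφR q hq).2]; rfl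
  have hφL : IsStraight φ L := fun q hq ↦ by rw [hR1 q hq, hR2 q hq, hL q (hφψ hq)]
  have hφp : φ p = axis 0 := by
    rw [eq_axis ((hφL p hpφ).1 hpL).1 ((hφL p hpφ).1 hpL).2, hR0 p hpφ, ← ha, hsa]
  refine ⟨φ, hφ, hpφ, hφp, hφL, ?_⟩
  obtain ⟨ε, hε, hεT⟩ := Metric.isOpen_iff.1
    (φ.open_target.preimage (contDiff_axis (n := 0)).continuous) 0
    (show axis 0 ∈ φ.target from hφp ▸ φ.map_source hpφ)
  rw [Real.ball_zero_eq_Ioo] at hεT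
  refine ⟨ε, hε, fun t ht ↦ ⟨hεT ht, ?_⟩⟩
  -- the inverse of the arc length
  let τ : ℝ → ℝ := fun t ↦ ψ (φ.symm (axis t)) 0
  have hT : ∀ t ∈ Ioo (-ε) ε, τ t ∈ J ∧ s (τ t) = t ∧ φ.symm (axis t) = ψ.symm (axis (τ t)) := by
    intro t ht
    have hm := φ.map_target (hεT ht)
    have hi := φ.right_inv (hεT ht)
    refine ⟨(hφR _ hm).1, ?_, ?_⟩
    · rw [← hR0 _ hm, hi]; simp [axis]
    · rw [← eq_axis, ψ.left_inv (hφψ hm)]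
      · rw [← hR1 _ hm, hi]; simp [axis]
      · rw [← hR2 _ hm, hi]; simp [axis]
  have hτc : ContinuousAt τ t := by
    have h1 : ContinuousAt (fun t ↦ φ.symm (axis t)) t :=
      ContinuousAt.comp (f := axis) (φ.symm.continuousAt (hεT ht))
        (contDiff_axis (n := 0)).continuous.continuousAt
    have h2 : ContinuousAt ψ (φ.symm (axis t)) :=
      ψ.continuousAt (hφψ (φ.map_target (hεT ht)))
    have h3 : Continuous fun x : EuclideanSpace ℝ (Fin 3) ↦ x 0 := by fun_prop
    exact h3.continuousAt.comp (h2.comp (f := fun t ↦ φ.symm (axis t)) h1)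
  have hnear : ∀ᶠ u in 𝓝 t, u ∈ Ioo (-ε) ε := isOpen_Ioo.mem_nhds ht
  have hτJ := (hT t ht).1
  have hvt : ‖deriv c (τ t)‖ ≠ 0 := norm_ne_zero_iff.2 (hcd _ hτJ)
  have hτd : HasDerivAt τ ‖deriv c (τ t)‖⁻¹ t :=
    HasDerivAt.of_local_left_inverse hτc (hsd _ hτJ) hvt (hnear.mono fun u hu ↦ (hT u hu).2.1)
  have hcder : HasDerivAt c (deriv c (τ t)) (τ t) :=
    ((hcC.contDiffAt (isOpen_Ioo.mem_nhds hτJ)).differentiableAt hr0).hasDerivAt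
  refine ⟨_, ?_, (hcder.scomp t hτd).congr_of_eventuallyEq (hnear.mono fun u hu ↦ ?_)⟩
  · rw [norm_smul, norm_inv, norm_norm, inv_mul_cancel₀ hvt]
  · simp only [Function.comp, hc, (hT u hu).2.2]

end

/-! ### From straight charts to finite links -/

noncomputable section

variable {M : Type*} [TopologicalSpace M] [ChartedSpace (EuclideanSpace ℝ (Fin 3)) M]

/-- A straight chart around `p` in which the axis is parametrized by arc length with respect
to `e`. -/
structure UnitChart (r : ℕ∞) {n : ℕ} (e : M → EuclideanSpace ℝ (Fin n)) (L : Set M) (p : M) where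
  /-- The chart. -/
  φ : OpenPartialHomeomorph M (EuclideanSpace ℝ (Fin 3))
  mem_maximalAtlas : φ ∈ IsManifold.maximalAtlas (𝓡 3) r M
  mem_source : p ∈ φ.source
  apply_self : φ p = axis 0
  isStraight : IsStraight φ L
  /-- Half of the length of the axis in the chart. -/
  ε : ℝ
  ε_pos : 0 < ε
  mem_target : ∀ t ∈ Ioo (-ε) ε, axis t ∈ φ.target
  deriv_spec : ∀ t ∈ Ioo (-ε) ε, ∃ c', ‖c'‖ = 1 ∧ HasDerivAt (fun t ↦ e (φ.symm (axis t))) c' t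

namespace UnitChart

variable {r : ℕ∞} {n : ℕ} {e : M → EuclideanSpace ℝ (Fin n)} {L : Set M} {p q : M}

lemma symm_axis_mem (C : UnitChart r e L p) {t : ℝ} (ht : t ∈ Ioo (-C.ε) C.ε) :
    C.φ.symm (axis t) ∈ L := by
  rw [C.isStraight _ (C.φ.map_target (C.mem_target t ht)), C.φ.right_inv (C.mem_target t ht)]
  simp [axis]

lemma axis_zero_eq (t : ℝ) : axis t 0 = t := by simp [axis]

/-- Both axes are parametrized by the arc length of the same image under `e`, so the transition
function has derivative `±1`. The derivative is continuous, hence locally constant, and the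
transition is affine. -/
lemma eventually_eq_add (hr : 1 ≤ r) [IsManifold (𝓡 3) ∞ M] (C : UnitChart r e L p)
    (D : UnitChart r e L q) {s t : ℝ}
    (hs : s ∈ Ioo (-C.ε) C.ε) (ht : t ∈ Ioo (-D.ε) D.ε)
    (h : C.φ.symm (axis s) = D.φ.symm (axis t)) :
    ∃ σ : ℝ, (σ = 1 ∨ σ = -1) ∧
      ∀ᶠ u in 𝓝 0, C.φ.symm (axis (s + u)) = D.φ.symm (axis (t + σ * u)) := by
  have := isManifold_of_smooth (M := M) r
  have hr1 : (1 : ℕ∞ω) ≤ r := by exact_mod_cast hr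
  -- the transition function
  let τ : ℝ → ℝ := fun u ↦ D.φ (C.φ.symm (axis u)) 0
  have hτs : τ s = t := by
    simp only [τ, h, D.φ.right_inv (D.mem_target t ht), axis_zero_eq]
  let O := {x | x ∈ C.φ.target ∧ C.φ.symm x ∈ D.φ.source}
  have hO : IsOpen O := C.φ.symm.isOpen_inter_preimage D.φ.open_source
  have hsO : axis s ∈ O := ⟨C.mem_target s hs, h ▸ D.φ.map_target (D.mem_target t ht)⟩
  have hcomp : ContDiffOn ℝ 1 (D.φ ∘ C.φ.symm) O :=
    (((contMDiffOn_of_mem_maximalAtlas D.mem_maximalAtlas).comp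
      ((contMDiffOn_symm_of_mem_maximalAtlas C.mem_maximalAtlas).mono (fun x hx ↦ hx.1))
      (fun x hx ↦ hx.2)).contDiffOn).of_le hr1
  have hτC : ContDiffAt ℝ 1 τ s := by
    have h1 : ContDiffAt ℝ 1 (fun u ↦ (D.φ ∘ C.φ.symm) (axis u)) s :=
      (hcomp.contDiffAt (hO.mem_nhds hsO)).comp s contDiff_axis.contDiffAt
    exact (contDiffAt_euclidean.1 h1) 0
  have hev : ∀ᶠ u in 𝓝 s, u ∈ Ioo (-C.ε) C.ε ∧ τ u ∈ Ioo (-D.ε) D.ε ∧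
      C.φ.symm (axis u) = D.φ.symm (axis (τ u)) := by
    have h1 : ∀ᶠ u in 𝓝 s, axis u ∈ O :=
      (contDiff_axis (n := 0)).continuous.continuousAt.eventually (hO.mem_nhds hsO)
    have h2 : ∀ᶠ u in 𝓝 s, τ u ∈ Ioo (-D.ε) D.ε :=
      hτC.continuousAt.eventually (isOpen_Ioo.mem_nhds (by rwa [hτs]))
    filter_upwards [h1, h2, isOpen_Ioo.mem_nhds hs] with u h1 h2 h3
    refine ⟨h3, h2, ?_⟩
    obtain ⟨h4, h5⟩ := (D.isStraight _ h1.2).1 (C.symm_axis_mem h3)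
    rw [← eq_axis h4 h5, D.φ.left_inv h1.2]
  have hd : ∀ᶠ u in 𝓝 s, HasDerivAt τ (deriv τ u) u ∧ |deriv τ u| = 1 := by
    have h1 : ∀ᶠ u in 𝓝 s, ContDiffAt ℝ 1 τ u := hτC.eventually (by simp)
    filter_upwards [h1, eventually_eventually_nhds.2 hev] with u h1 h2
    have h3 := (h1.differentiableAt one_ne_zero).hasDerivAt
    refine ⟨h3, ?_⟩
    obtain ⟨h4, h5, h6⟩ := h2.self_of_nhds
    obtain ⟨c, hc, hcd⟩ := C.deriv_spec u h4
    obtain ⟨d, hd, hdd⟩ := D.deriv_spec _ h5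
    have h7 := (hdd.scomp u h3).congr_of_eventuallyEq
      (f₁ := fun t ↦ e (C.φ.symm (axis t))) (h2.mono fun v hv ↦ by simp only [hv.2.2, Function.comp])
    have h8 := congrArg norm (hcd.unique h7)
    rwa [norm_smul, hc, hd, mul_one, Real.norm_eq_abs, eq_comm] at h8
  have hdc : ContinuousAt (deriv τ) s := by
    have := (hτC.fderiv_right (m := 0) (by simp)).continuousAt
    exact (this.clm_apply continuousAt_const : ContinuousAt (fun x ↦ fderiv ℝ τ x 1) s)
  have hσ : deriv τ s = 1 ∨ deriv τ s = -1 := by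
    have := hd.self_of_nhds.2
    rcases abs_choice (deriv τ s) with h | h <;> rw [h] at this
    · exact Or.inl this
    · right; linarith
  refine ⟨deriv τ s, hσ, ?_⟩
  have hconst : ∀ᶠ u in 𝓝 s, HasDerivAt τ (deriv τ s) u := by
    have h1 : ∀ᶠ u in 𝓝 s, |deriv τ u - deriv τ s| < 1 := by
      have := hdc.eventually (Metric.ball_mem_nhds _ one_pos)
      simpa [Real.dist_eq] using this
    filter_upwards [hd, h1] with u h2 h3
    have : deriv τ u = deriv τ s := by
      rcases abs_choice (deriv τ u) with h | h <;> rw [h] at h2 <;>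
      rcases hσ with h4 | h4 <;> rw [h4] at h3 ⊢ <;> rw [abs_lt] at h3 <;> linarith [h2.2, h3.1, h3.2]
    rw [← this]; exact h2.1
  obtain ⟨δ, hδ, hb⟩ := Metric.eventually_nhds_iff_ball.1 hconst
  have hlin : ∀ u ∈ Metric.ball s δ, τ u = t + deriv τ s * (u - s) := by
    intro u hu
    have h1 : ∀ x ∈ Metric.ball s δ,
        HasDerivAt (fun x ↦ τ x - (t + deriv τ s * (x - s))) 0 x := fun x hx ↦ by
      have h2 : HasDerivAt (fun x ↦ t + deriv τ s * (x - s)) (deriv τ s) x := by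
        simpa using (((hasDerivAt_id x).sub_const s).const_mul (deriv τ s)).const_add t
      simpa using HasDerivAt.fun_sub (hb x hx) h2
    have h2 := Metric.isOpen_ball.is_const_of_deriv_eq_zero
      (convex_ball s δ).isPreconnected (fun x hx ↦ (h1 x hx).differentiableAt.differentiableWithinAt)
      (fun x hx ↦ (h1 x hx).deriv) hu (Metric.mem_ball_self hδ)
    simp only [hτs, sub_self, mul_zero, add_zero] at h2
    linarith
  have hfin : ∀ᶠ x in 𝓝 s, C.φ.symm (axis x) = D.φ.symm (axis (t + deriv τ s * (x - s))) := by
    filter_upwards [hev, Metric.ball_mem_nhds s hδ] with x h1 h2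
    rw [h1.2.2, hlin x h2]
  refine (UnitAtlas.eventually_add_iff.2 hfin).mono fun u hu ↦ ?_
  rw [hu, add_sub_cancel_left]

open Classical in
/-- The arc of a unit chart, as a curve in the set. -/
def arc (C : UnitChart r e L p) (p' : L) (t : ℝ) : L :=
  if ht : t ∈ Ioo (-C.ε) C.ε then ⟨_, C.symm_axis_mem ht⟩ else p'

lemma coe_arc (C : UnitChart r e L p) (p' : L) {t : ℝ} (ht : t ∈ Ioo (-C.ε) C.ε) :
    (C.arc p' t : M) = C.φ.symm (axis t) := by
  rw [arc, dif_pos ht]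

/-- The atlas of arcs of a set that is covered by unit charts. -/
def toUnitAtlas (hr : 1 ≤ r) [IsManifold (𝓡 3) ∞ M] (C : ∀ p : L, UnitChart r e L p) :
    UnitAtlas L where
  arc p := (C p).arc p
  rad p := (C p).ε
  rad_pos p := (C p).ε_pos
  arc_zero p := by
    have h := (C p).ε_pos
    ext
    rw [coe_arc _ _ ⟨by linarith, h⟩, ← (C p).apply_self, (C p).φ.left_inv (C p).mem_source]
  continuousOn p := by
    rw [IsInducing.subtypeVal.continuousOn_iff]
    refine ContinuousOn.congr (f := fun t ↦ (C p).φ.symm (axis t)) ?_ fun t ht ↦ coe_arc _ _ ht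
    exact (C p).φ.symm.continuousOn.comp (contDiff_axis (n := 0)).continuous.continuousOn
      (C p).mem_target
  injOn p := by
    intro s hs t ht h
    have h := congrArg Subtype.val h
    rw [coe_arc _ _ hs, coe_arc _ _ ht] at h
    have := (C p).φ.symm.injOn ((C p).mem_target s hs) ((C p).mem_target t ht) h
    rw [← axis_zero_eq s, this, axis_zero_eq]
  isOpen_image p U hU hUo := by
    have h1 : IsOpen ((C p).φ.source ∩ (C p).φ ⁻¹' {x | x 0 ∈ U}) :=
      (C p).φ.isOpen_inter_preimage (hUo.preimage (by fun_prop))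
    convert! h1.preimage continuous_subtype_val using 1
    ext q
    constructor
    · rintro ⟨t, ht, rfl⟩
      have hm := (C p).mem_target t (hU ht)
      rw [mem_preimage, coe_arc _ _ (hU ht)]
      refine ⟨(C p).φ.map_target hm, ?_⟩
      rw [mem_preimage, (C p).φ.right_inv hm, mem_ofPred_eq, axis_zero_eq]
      exact ht
    · rintro ⟨h1, h2⟩
      refine ⟨_, h2, Subtype.ext ?_⟩
      rw [coe_arc _ _ (hU h2)]
      obtain ⟨h3, h4⟩ := ((C p).isStraight _ h1).1 q.2
      rw [← eq_axis h3 h4, (C p).φ.left_inv h1]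
  compat p q s t hs ht h := by
    have h := congrArg Subtype.val h
    rw [coe_arc _ _ hs, coe_arc _ _ ht] at h
    obtain ⟨σ, hσ, hu⟩ := (C p).eventually_eq_add hr (C q) hs ht h
    refine ⟨σ, hσ, ?_⟩
    filter_upwards [hu, UnitAtlas.eventually_add_iff.2 (isOpen_Ioo.mem_nhds hs),
      (UnitAtlas.tendsto_affine t σ).eventually (isOpen_Ioo.mem_nhds ht)] with u h1 h2 h3
    ext
    rw [coe_arc _ _ h2, coe_arc _ _ h3, h1]

end UnitChart

/-- A compact subset of a 3-manifold that is a straight line in suitable charts around its points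
is a finite link. -/
theorem isFiniteLink_of_isStraight [T2Space M] [CompactSpace M] [IsManifold (𝓡 3) ∞ M] {r : ℕ∞}
    (hr : 1 ≤ r) {L : Set M} (hL : IsClosed L)
    (hstr : ∀ p ∈ L, ∃ ψ ∈ IsManifold.maximalAtlas (𝓡 3) r M, p ∈ ψ.source ∧ IsStraight ψ L) :
    IsFiniteLink r L := by
  -- Only smoothness and injectivity of the differential are kept: `e` serves to measure lengths
  -- consistently in all charts.
  obtain ⟨n, e, he, -, hei⟩ := exists_embedding_euclidean_of_compact (I := 𝓡 3) (M := M)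
  have hC : ∀ p : L, Nonempty (UnitChart r e L p) := by
    intro p
    obtain ⟨ψ, hψ, hp, hs⟩ := hstr p p.2
    obtain ⟨φ, hφ, hpφ, hp0, hφs, ε, hε, h⟩ := exists_unit_chart hr he hei p.2 hψ hp hs
    exact ⟨⟨φ, hφ, hpφ, hp0, hφs, ε, hε, fun t ht ↦ (h t ht).1, fun t ht ↦ (h t ht).2⟩⟩
  let C : ∀ p : L, UnitChart r e L p := fun p ↦ (hC p).some
  let A := UnitChart.toUnitAtlas hr C
  have hLc : CompactSpace L := isCompact_iff_compactSpace.1 hL.isCompact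
  -- The closed curve through `p` has connected image, open because it contains whole arcs and
  -- closed because it is compact. So it is the component of `p`.
  have key : ∀ p : L, ∃ f : Circle → M, IsSmoothEmbedding (𝓡 1) (𝓡 3) r f ∧
      range f = Subtype.val '' connectedComponent p ∧ IsOpen (connectedComponent p) := by
    intro p
    obtain ⟨γ, T, hT, hγ, hpγ, hper⟩ := A.exists_closed_curve p
    obtain ⟨f, hf, hfr⟩ := exists_isSmoothEmbedding_of_closed_curve (M := M) (r := r)
      (γ := fun t ↦ (γ t : M)) hT (fun s t ↦ by rw [← Subtype.ext_iff, hper]) (by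
        intro t
        refine ⟨(C (γ t)).φ, (C (γ t)).mem_maximalAtlas, (C (γ t)).mem_source, ?_⟩
        obtain ⟨σ, hσ, hu⟩ := hγ t
        refine ⟨σ, hσ, ?_⟩
        filter_upwards [hu, (UnitAtlas.tendsto_mul_zero σ).eventually (isOpen_Ioo.mem_nhds
          (UnitAtlas.zero_mem (A := A) (γ t)))] with u h1 h2
        have h3 : (γ (t + u) : M) = (C (γ t)).φ.symm (axis (σ * u)) := by
          rw [h1]; exact UnitChart.coe_arc _ _ h2
        have h4 := (C (γ t)).mem_target _ h2
        rw [h3]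
        exact ⟨(C (γ t)).φ.map_target h4, (C (γ t)).φ.right_inv h4⟩)
    have hγc : Continuous γ := continuous_iff_continuousAt.2 fun t ↦ (hγ t).continuousAt
    have hopen : IsOpen (range γ) := by
      rw [isOpen_iff_mem_nhds]
      rintro _ ⟨t, rfl⟩
      obtain ⟨σ, hσ, hu⟩ := hγ t
      have hu' : ∀ᶠ v in 𝓝 0, A.arc (γ t) v ∈ range γ := by
        filter_upwards [(UnitAtlas.tendsto_mul_zero σ).eventually hu] with v hv
        rw [← mul_assoc, UnitAtlas.sign_mul_self hσ, one_mul] at hv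
        exact ⟨_, hv⟩
      obtain ⟨U, hU, hUo, h0⟩ := eventually_nhds_iff.1
        (hu'.and (isOpen_Ioo.mem_nhds (UnitAtlas.zero_mem (A := A) (γ t))))
      refine Filter.mem_of_superset
        ((A.isOpen_image (γ t) U (fun x hx ↦ (hU x hx).2) hUo).mem_nhds ⟨0, h0, A.arc_zero _⟩) ?_
      rintro _ ⟨v, hv, rfl⟩
      exact (hU v hv).1
    have hfr' : range f = Subtype.val '' range γ := by
      rw [hfr, ← range_comp]; rfl
    have hclosed : IsClosed (range γ) := by
      have h1 : IsClosed (range f) := (isCompact_range hf.isEmbedding.continuous).isClosed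
      rw [hfr'] at h1
      have := h1.preimage (continuous_subtype_val (p := (· ∈ L)))
      rwa [preimage_image_eq _ Subtype.val_injective] at this
    have heq : range γ = connectedComponent p :=
      ((isPreconnected_range hγc).subset_connectedComponent hpγ).antisymm
        (IsClopen.connectedComponent_subset ⟨hclosed, hopen⟩ hpγ)
    exact ⟨f, hf, by rw [hfr', heq], heq ▸ hopen⟩
  choose f hf hfr hfo using key
  have hfin : Finite (ConnectedComponents L) := by
    have : DiscreteTopology (ConnectedComponents L) := by
      rw [discreteTopology_iff_isOpen_singleton]
      intro x
      obtain ⟨p, rfl⟩ := ConnectedComponents.surjective_coe x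
      rw [← ConnectedComponents.isQuotientMap_coe.isOpen_preimage, connectedComponents_preimage_singleton]
      exact hfo p
    exact finite_of_compact_of_discrete
  obtain ⟨m, ⟨E⟩⟩ := Finite.exists_equiv_fin (ConnectedComponents L)
  choose rep hrep using ConnectedComponents.surjective_coe (α := L)
  refine ⟨m, fun i ↦ f (rep (E.symm i)), fun i ↦ hf _, fun i j hij ↦ ?_, ?_⟩
  · rw [hfr, hfr]
    refine (disjoint_image_iff Subtype.val_injective).2 (connectedComponent_disjoint ?_)
    intro h
    rw [← ConnectedComponents.coe_eq_coe, hrep, hrep] at h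
    exact hij (E.symm.injective h)
  · ext x
    simp only [mem_iUnion, hfr]
    constructor
    · intro hx
      refine ⟨E (ConnectedComponents.mk ⟨x, hx⟩), ⟨x, hx⟩, ?_, rfl⟩
      rw [Equiv.symm_apply_apply, ← ConnectedComponents.coe_eq_coe', hrep]
    · rintro ⟨i, y, -, rfl⟩
      exact y.2

end

/-! ### Regular values and generic perturbations -/

noncomputable section

local notation "E₂" => EuclideanSpace ℝ (Fin 2)
local notation "E₃" => EuclideanSpace ℝ (Fin 3)

/-- If `B` is a right inverse of `A`, then `C ∘ B` is invertible for `C` near `A`, which makes `C`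
surjective. -/
lemma isOpen_surjective {E F : Type*} [NormedAddCommGroup E] [NormedSpace ℝ E]
    [NormedAddCommGroup F] [NormedSpace ℝ F] [FiniteDimensional ℝ F] :
    IsOpen {A : E →L[ℝ] F | Function.Surjective A} := by
  have : CompleteSpace F := FiniteDimensional.complete ℝ F
  rw [isOpen_iff_mem_nhds]
  intro A hA
  obtain ⟨B, hB⟩ := (A : E →ₗ[ℝ] F).exists_rightInverse_of_surjective (LinearMap.range_eq_top.2 hA)
  let B' : F →L[ℝ] E := LinearMap.toContinuousLinearMap B
  have hcont : Continuous fun C : E →L[ℝ] F ↦ C.comp B' := by fun_prop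
  have h1 : A.comp B' ∈ {C : F →L[ℝ] F | IsUnit C} := by
    have : A.comp B' = 1 := by ext x; exact congrArg (fun f ↦ f x) hB
    rw [this]; exact isUnit_one
  filter_upwards [hcont.continuousAt.preimage_mem_nhds (Units.isOpen.mem_nhds h1)] with C hC
  obtain ⟨U, hU⟩ := hC
  intro y
  refine ⟨B' ((U⁻¹ : (F →L[ℝ] F)ˣ).1 y), ?_⟩
  have h2 : C.comp B' ((U⁻¹ : (F →L[ℝ] F)ˣ).1 y) = (U.1 * (U⁻¹ : (F →L[ℝ] F)ˣ).1) y := by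
    rw [hU]; rfl
  rw [U.mul_inv] at h2
  exact h2

/-- The vector `v` spans the one-dimensional kernel, so pairing with `v` is injective on it. -/
lemma exists_equiv_of_surjective {A : E₃ →L[ℝ] E₂} (hA : Function.Surjective A) :
    ∃ (v : E₃) (R : E₃ ≃L[ℝ] E₃), ∀ x, R x = !₂[inner ℝ v x, A x 0, A x 1] := by
  have hker : Module.finrank ℝ (LinearMap.ker (A : E₃ →ₗ[ℝ] E₂)) = 1 := by
    have h1 := (A : E₃ →ₗ[ℝ] E₂).finrank_range_add_finrank_ker
    rw [LinearMap.range_eq_top.2 hA, finrank_top] at h1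
    simp only [finrank_euclideanSpace, Fintype.card_fin] at h1
    omega
  obtain ⟨v, hv0, hv⟩ := finrank_eq_one_iff'.1 hker
  let R : E₃ →ₗ[ℝ] E₃ :=
    { toFun := fun x ↦ !₂[inner ℝ (v : E₃) x, A x 0, A x 1]
      map_add' := fun x y ↦ by ext i; fin_cases i <;> simp [inner_add_right]
      map_smul' := fun c x ↦ by ext i; fin_cases i <;> simp [inner_smul_right] }
  have hR : Function.Injective R := by
    rw [injective_iff_map_eq_zero]
    intro x hx
    have h0 : inner ℝ (v : E₃) x = 0 := congrArg (fun y : E₃ ↦ y 0) hx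
    have h1 : A x 0 = 0 := congrArg (fun y : E₃ ↦ y 1) hx
    have h2 : A x 1 = 0 := congrArg (fun y : E₃ ↦ y 2) hx
    have hAx : A x = 0 := by ext i; fin_cases i <;> simp [h1, h2]
    obtain ⟨c, hc⟩ := hv ⟨x, hAx⟩
    have hc' : c • (v : E₃) = x := congrArg Subtype.val hc
    rw [← hc', inner_smul_right, mul_eq_zero, inner_self_eq_zero] at h0
    rcases h0 with h0 | h0
    · rw [← hc', h0, zero_smul]
    · exact (hv0 (Subtype.ext h0)).elim
  exact ⟨v, (LinearEquiv.ofInjectiveEndo R hR).toContinuousLinearEquiv, fun x ↦ rfl⟩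

/-- A linear map onto the plane is surjective unless its components are proportional. -/
lemma eq_smul_of_not_surjective {B : E₃ →L[ℝ] E₂} (hB : ¬ Function.Surjective B) :
    ∃ (t : ℝ) (v : E₃ →L[ℝ] ℝ), (∀ x, B x = !₂[v x, t * v x]) ∨ ∀ x, B x = !₂[t * v x, v x] := by
  have hr : LinearMap.range (B : E₃ →ₗ[ℝ] E₂) ≠ ⊤ := fun h ↦ hB (LinearMap.range_eq_top.1 h)
  have hne : (LinearMap.range (B : E₃ →ₗ[ℝ] E₂))ᗮ ≠ ⊥ := fun h ↦
    hr (Submodule.orthogonal_eq_bot_iff.1 h)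
  -- A nonzero vector orthogonal to the range is a linear relation between the two components of
  -- `B`.
  obtain ⟨w, hw, hw0⟩ := Submodule.exists_mem_ne_zero_of_ne_bot hne
  have horth : ∀ x, B x 0 * w 0 + B x 1 * w 1 = 0 := by
    intro x
    have := (Submodule.mem_orthogonal _ _).1 hw (B x) ⟨x, rfl⟩
    simpa [PiLp.inner_apply, Fin.sum_univ_two, mul_comm] using this
  by_cases h1 : w 1 = 0
  · have h0 : w 0 ≠ 0 := fun h0 ↦ hw0 (by ext i; fin_cases i <;> simp [h0, h1])
    refine ⟨0, (EuclideanSpace.proj 1 : E₂ →L[ℝ] ℝ).comp B, Or.inr fun x ↦ ?_⟩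
    have := horth x
    rw [h1, mul_zero, add_zero, mul_eq_zero] at this
    ext i; fin_cases i
    · simpa using this.resolve_right h0
    · simp
  · refine ⟨-(w 0 / w 1), (EuclideanSpace.proj 0 : E₂ →L[ℝ] ℝ).comp B, Or.inl fun x ↦ ?_⟩
    have := horth x
    ext i; fin_cases i
    · simp
    · simp; field_simp; linarith

/-- A generic affine perturbation of a `C²` map has zero as a regular value. -/
theorem dense_affine_perturbations {F : E₃ → E₂} (hF : ContDiff ℝ 2 F) :
    Dense {b : E₂ × (E₃ →L[ℝ] E₂) | ∀ u, F u + (b.1 + b.2 u) = 0 →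
      Function.Surjective (fderiv ℝ F u + b.2)} := by
  -- `V₁` and `V₂` together parametrize the maps of rank at most one by four parameters: a row and
  -- the ratio of the other row to it.
  let V₁ : ℝ × (E₃ →L[ℝ] ℝ) → (E₃ →L[ℝ] E₂) := fun q ↦
    q.2.smulRight (!₂[1, 0] : E₂) + (q.1 • q.2).smulRight (!₂[0, 1] : E₂)
  let V₂ : ℝ × (E₃ →L[ℝ] ℝ) → (E₃ →L[ℝ] E₂) := fun q ↦
    (q.1 • q.2).smulRight (!₂[1, 0] : E₂) + q.2.smulRight (!₂[0, 1] : E₂)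
  have hsr : ∀ w : E₂, ContDiff ℝ 1 fun f : E₃ →L[ℝ] ℝ ↦ f.smulRight w := fun w ↦
    (((ContinuousLinearMap.smulRightL ℝ E₃ E₂).flip w).contDiff : _)
  have hV₁ : ContDiff ℝ 1 V₁ := ((hsr _).comp contDiff_snd).add
    ((hsr _).comp (contDiff_fst.smul contDiff_snd))
  have hV₂ : ContDiff ℝ 1 V₂ := ((hsr _).comp (contDiff_fst.smul contDiff_snd)).add
    ((hsr _).comp contDiff_snd)
  -- A degenerate zero `u` with degenerate derivative `V` determines the perturbation: `b.2 = V -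
  -- fderiv ℝ F u` and `b.1 = -F u - b.2 u`. The parameters number 3 + 4 = 7, against 2 + 6 = 8 for
  -- `b`.
  let B : (ℝ × (E₃ →L[ℝ] ℝ) → (E₃ →L[ℝ] E₂)) → E₃ × (ℝ × (E₃ →L[ℝ] ℝ)) → E₂ × (E₃ →L[ℝ] E₂) :=
    fun V q ↦ (-F q.1 - (V q.2 - fderiv ℝ F q.1) q.1, V q.2 - fderiv ℝ F q.1)
  have hB : ∀ V, ContDiff ℝ 1 V → dimH (range (B V)) ≤ 7 := by
    intro V hV
    have hd : ContDiff ℝ 1 (fderiv ℝ F) := hF.fderiv_right (by norm_num)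
    have h1 : ContDiff ℝ 1 fun q : E₃ × (ℝ × (E₃ →L[ℝ] ℝ)) ↦ V q.2 - fderiv ℝ F q.1 :=
      (hV.comp contDiff_snd).sub (hd.comp contDiff_fst)
    have h2 : ContDiff ℝ 1 (B V) :=
      ((((hF.of_le (by norm_num)).comp contDiff_fst).neg).sub (h1.clm_apply contDiff_fst)).prodMk h1
    refine h2.dimH_range_le.trans ?_
    have hfr : Module.finrank ℝ (E₃ →L[ℝ] ℝ) = 3 := by
      rw [← LinearMap.toContinuousLinearMap.finrank_eq, Module.finrank_linearMap]; simp
    rw [Module.finrank_prod, Module.finrank_prod, hfr]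
    norm_num
  have hfr : Module.finrank ℝ (E₂ × (E₃ →L[ℝ] E₂)) = 8 := by
    rw [Module.finrank_prod, ← LinearMap.toContinuousLinearMap.finrank_eq, Module.finrank_linearMap]
    simp
  refine (dense_compl_of_dimH_lt_finrank (s := range (B V₁) ∪ range (B V₂)) ?_).mono ?_
  · rw [dimH_union, hfr]
    refine (max_le (hB _ hV₁) (hB _ hV₂)).trans_lt (by norm_num)
  · rintro b hb u hu
    by_contra hns
    refine hb ?_
    obtain ⟨t, v, h | h⟩ := eq_smul_of_not_surjective hns
    · left
      have h1 : V₁ (t, v) = fderiv ℝ F u + b.2 := by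
        ext x i
        rw [h x]; fin_cases i <;> simp [V₁]
      refine ⟨(u, t, v), Prod.ext ?_ ?_⟩
      · simp only [B, h1, add_sub_cancel_left]
        rw [← sub_eq_zero, ← neg_eq_zero, ← hu]; abel
      · simp only [B, h1, add_sub_cancel_left]
    · right
      have h1 : V₂ (t, v) = fderiv ℝ F u + b.2 := by
        ext x i
        rw [h x]; fin_cases i <;> simp [V₂]
      refine ⟨(u, t, v), Prod.ext ?_ ?_⟩
      · simp only [B, h1, add_sub_cancel_left]
        rw [← sub_eq_zero, ← neg_eq_zero, ← hu]; abel
      · simp only [B, h1, add_sub_cancel_left]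

open MeasureTheory in
/-- Mollification is jointly `C^r` in the scale and in the point. -/
theorem exists_mollification {r : ℕ∞} {F : E₃ → E₂} (hF : ContDiff ℝ r F) :
    ∃ G : ℝ × E₃ → E₂, ContDiff ℝ r G ∧ (∀ x, G (0, x) = F x) ∧
      ∀ δ ≠ 0, ContDiff ℝ 2 fun x ↦ G (δ, x) := by
  let φ : ContDiffBump (0 : E₃) := ⟨1, 2, one_pos, one_lt_two⟩
  let θ : E₃ → ℝ := φ.normed volume
  have hθ : ∀ {n : ℕ∞}, ContDiff ℝ n θ := φ.contDiff_normed
  have hθc : HasCompactSupport θ := φ.hasCompactSupport_normed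
  let g : ℝ × E₃ → E₃ → E₂ := fun p z ↦ θ z • F (p.2 + p.1 • z)
  -- This is `∫ θ y • F (x + δ • y)`, which makes sense at `δ = 0`. Writing it as the value at `0`
  -- of a convolution with the constant `1` gives access to smooth dependence on parameters.
  let G : ℝ × E₃ → E₂ := fun p ↦
    convolution (fun _ : E₃ ↦ (1 : ℝ)) (g p) (ContinuousLinearMap.lsmul ℝ ℝ) volume 0
  have hG : ∀ p, G p = ∫ y, θ y • F (p.2 + p.1 • y) := by
    intro p
    simp only [G, convolution, ContinuousLinearMap.lsmul_apply, one_smul, zero_sub, g]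
    exact integral_neg_eq_self (fun y ↦ θ y • F (p.2 + p.1 • y)) volume
  have hFc : Continuous F := hF.continuous
  refine ⟨G, ?_, fun x ↦ ?_, fun δ hδ ↦ ?_⟩
  · rw [← contDiffOn_univ]
    refine contDiffOn_convolution_right_with_param_comp (g := g) (v := fun _ ↦ (0 : E₃))
      (ContinuousLinearMap.lsmul ℝ ℝ) contDiffOn_const isOpen_univ hθc.isCompact ?_ ?_ ?_
    · intro p x _ hx
      simp only [g, image_eq_zero_of_notMem_tsupport hx, zero_smul]
    · exact (continuous_const).locallyIntegrable
    · refine ContDiff.contDiffOn ?_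
      exact (hθ.comp contDiff_snd).smul (hF.comp
        ((contDiff_snd.comp contDiff_fst).add ((contDiff_fst.comp contDiff_fst).smul contDiff_snd)))
  · rw [hG]
    simp only [zero_smul, add_zero]
    rw [integral_smul_const, φ.integral_normed, one_smul]
  -- For `δ ≠ 0` a substitution moves the scale to the kernel, and convolving `F` with a smooth
  -- kernel of compact support gains the derivatives.
  · have h1 : ∀ x, G (δ, x) = |((-δ⁻¹) ^ 3)| •
        convolution (fun y ↦ θ ((-δ⁻¹) • y)) F (ContinuousLinearMap.lsmul ℝ ℝ) volume x := by
      intro x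
      have h2 := Measure.integral_comp_smul (volume : Measure E₃)
        (fun y ↦ θ y • F (x + δ • y)) (-δ⁻¹)
      rw [finrank_euclideanSpace, Fintype.card_fin] at h2
      rw [hG]
      simp only [convolution, ContinuousLinearMap.lsmul_apply]
      have h3 : (fun y ↦ θ (-δ⁻¹ • y) • F (x - y)) = fun y ↦ θ (-δ⁻¹ • y) • F (x + δ • (-δ⁻¹ • y)) := by
        ext1 y
        rw [smul_smul, mul_neg, mul_inv_cancel₀ hδ, neg_one_smul, sub_eq_add_neg]
      rw [h3, h2, smul_smul, ← abs_mul, mul_inv_cancel₀ (by simp [hδ]), abs_one, one_smul]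
    simp only [h1]
    refine ContDiff.const_smul _ ?_
    refine HasCompactSupport.contDiff_convolution_left (n := 2) _ ?_ ?_ hFc.locallyIntegrable
    · exact hθc.comp_smul (by simp [hδ])
    · exact (hθ (n := 2)).comp (by fun_prop : ContDiff ℝ 2 fun y : E₃ ↦ (-δ⁻¹) • y)

variable {M : Type*} [TopologicalSpace M] [ChartedSpace E₃ M]

/-- A regular zero set is straight in a suitable chart. -/
lemma exists_isStraight_of_regular [IsManifold (𝓡 3) ∞ M] {r : ℕ∞} (hr : 1 ≤ r)
    {ψ : OpenPartialHomeomorph M E₃} (hψ : ψ ∈ IsManifold.maximalAtlas (𝓡 3) r M) {p : M}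
    (hp : p ∈ ψ.source) {W : Set E₃} (hW : IsOpen W) (hpW : ψ p ∈ W) {F : E₃ → E₂}
    (hF : ContDiffOn ℝ r F W) {L : Set M}
    (hL : ∀ q ∈ ψ.source, ψ q ∈ W → (q ∈ L ↔ F (ψ q) = 0))
    (hs : Function.Surjective (fderiv ℝ F (ψ p))) :
    ∃ φ ∈ IsManifold.maximalAtlas (𝓡 3) r M, p ∈ φ.source ∧ IsStraight φ L := by
  have hr0 : (r : ℕ∞ω) ≠ 0 := by
    have : r ≠ 0 := by rintro rfl; simp at hr
    exact_mod_cast this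
  obtain ⟨v, R', hR'⟩ := exists_equiv_of_surjective hs
  -- A linear functional completes `F` to a local diffeomorphism whose last two coordinates are
  -- those of `F`.
  let R : E₃ → E₃ := fun x ↦ !₂[inner ℝ v x, F x 0, F x 1]
  have hpr : ∀ i : Fin 2, ContDiff ℝ r (fun x : E₂ ↦ x i) := fun i ↦ by fun_prop
  have hR : ContDiffOn ℝ r R W := by
    rw [contDiffOn_euclidean]
    intro i
    fin_cases i
    · exact (contDiff_const.inner ℝ contDiff_id).contDiffOn
    · exact (hpr 0).comp_contDiffOn hF
    · exact (hpr 1).comp_contDiffOn hF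
  have hFd : HasFDerivAt F (fderiv ℝ F (ψ p)) (ψ p) :=
    ((hF.contDiffAt (hW.mem_nhds hpW)).differentiableAt hr0).hasFDerivAt
  have hRd : HasFDerivAt R (R' : E₃ →L[ℝ] E₃) (ψ p) := by
    rw [← hasFDerivWithinAt_univ, hasFDerivWithinAt_euclidean]
    intro i
    rw [hasFDerivWithinAt_univ]
    have hpd : ∀ i : Fin 2, HasFDerivAt (fun x ↦ F x i)
        ((EuclideanSpace.proj i : E₂ →L[ℝ] ℝ).comp (fderiv ℝ F (ψ p))) (ψ p) := fun i ↦
      (EuclideanSpace.proj i : E₂ →L[ℝ] ℝ).hasFDerivAt.comp (ψ p) hFd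
    fin_cases i
    · convert! (innerSL ℝ v).hasFDerivAt using 1
      ext x; simp [hR']
    · convert! hpd 0 using 1
      ext x; simp [hR']
    · convert! hpd 1 using 1
      ext x; simp [hR']
  obtain ⟨φ, hφ, hpφ, hφψ, hφR⟩ := exists_chart_postcomp hr hψ hp hW hpW hR R' hRd
  refine ⟨φ, hφ, hpφ, fun q hq ↦ ?_⟩
  obtain ⟨h1, h2⟩ := hφR q hq
  rw [hL q (hφψ hq) h1, h2]
  constructor
  · intro h; simp [R, h]
  · rintro ⟨h3, h4⟩
    ext i; fin_cases i
    · simpa [R] using h3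
    · simpa [R] using h4

end

/-! ### Local form of plane fields and the topology on sections -/

noncomputable section

local notation "E₂" => EuclideanSpace ℝ (Fin 2)
local notation "E₃" => EuclideanSpace ℝ (Fin 3)

variable {M : Type*} [TopologicalSpace M] [ChartedSpace E₃ M] [IsManifold (𝓡 3) ∞ M]

/-- The coordinates of a tangent vector in the preferred chart at `c`. -/
def tangentCoord (c q : M) (v : TangentSpace (𝓡 3) q) : E₃ :=
  (trivializationAt E₃ (TangentSpace (𝓡 3) : M → Type _) c ⟨q, v⟩).2

/-- The coordinates of tangent vectors over the domain of the preferred chart at `c`. -/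
def tangentCoordEquiv (c q : M) (hq : q ∈ (chartAt E₃ c).source) : TangentSpace (𝓡 3) q ≃L[ℝ] E₃ :=
  (trivializationAt E₃ (TangentSpace (𝓡 3) : M → Type _) c).continuousLinearEquivAt ℝ q
    (by rwa [TangentBundle.trivializationAt_baseSet])

lemma tangentCoordEquiv_apply (c q : M) (hq : q ∈ (chartAt E₃ c).source)
    (v : TangentSpace (𝓡 3) q) : tangentCoordEquiv c q hq v = tangentCoord c q v := rfl

/-- The expression of a vector field in the preferred chart at `c`. -/
def fieldRep (V : ∀ q : M, TangentSpace (𝓡 3) q) (c : M) (u : E₃) : E₃ :=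
  tangentCoord c ((chartAt E₃ c).symm u) (V ((chartAt E₃ c).symm u))

lemma localRep_eq_fieldRep {r : ℕ∞} {η : PlaneField r M} (X : η.Sections) (c : M) :
    X.localRep c = fieldRep X.toField c := rfl

lemma contMDiffVectorBundle_tangent (r : ℕ∞) :
    ContMDiffVectorBundle r E₃ (TangentSpace (𝓡 3) : M → Type _) (𝓡 3) := by
  have : IsManifold (𝓡 3) ((r : ℕ∞ω) + 1) M := by
    exact_mod_cast isManifold_of_smooth (M := M) (r + 1)
  exact TangentBundle.contMDiffVectorBundle

lemma chart_mem_maximalAtlas' (r : ℕ∞) (c : M) :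
    chartAt E₃ c ∈ IsManifold.maximalAtlas (𝓡 3) r M := by
  have := isManifold_of_smooth (M := M) r
  exact IsManifold.chart_mem_maximalAtlas c

lemma contDiffOn_fieldRep {r : ℕ∞} {V : ∀ q : M, TangentSpace (𝓡 3) q} {U : Set M} (hU : IsOpen U)
    (hV : ContMDiffOn (𝓡 3) (𝓡 3).tangent r (fun q ↦ (⟨q, V q⟩ : TangentBundle (𝓡 3) M)) U) (c : M) :
    ContDiffOn ℝ r (fieldRep V c) ((chartAt E₃ c).target ∩ (chartAt E₃ c).symm ⁻¹' U) := by
  have := contMDiffVectorBundle_tangent (M := M) r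
  have h1 := ((trivializationAt E₃ (TangentSpace (𝓡 3) : M → Type _) c).contMDiffOn_section_iff
    (n := r) (IB := 𝓡 3) (s := V) (hU.inter (trivializationAt E₃ (TangentSpace (𝓡 3) : M → Type _) c).open_baseSet)
    inter_subset_right).1 (hV.mono inter_subset_left)
  have h2 := contMDiffOn_symm_of_mem_maximalAtlas (chart_mem_maximalAtlas' r c)
  refine (h1.comp (h2.mono inter_subset_left) ?_).contDiffOn
  intro u hu
  refine ⟨hu.2, ?_⟩
  rw [TangentBundle.trivializationAt_baseSet]
  exact (chartAt E₃ c).map_target hu.1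

lemma contMDiff_of_fieldRep {r : ℕ∞} {V : ∀ q : M, TangentSpace (𝓡 3) q}
    (hV : ∀ c, ContDiffOn ℝ r (fieldRep V c) (chartAt E₃ c).target) :
    ContMDiff (𝓡 3) (𝓡 3).tangent r (fun q ↦ (⟨q, V q⟩ : TangentBundle (𝓡 3) M)) := by
  have := contMDiffVectorBundle_tangent (M := M) r
  intro c
  refine (Bundle.contMDiffAt_section c).2 ?_
  have h1 := contMDiffAt_of_mem_maximalAtlas (chart_mem_maximalAtlas' r c) (mem_chart_source E₃ c)
  have h2 := ((hV c).contDiffAt ((chartAt E₃ c).open_target.mem_nhds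
    (mem_chart_target E₃ c))).contMDiffAt.comp c h1
  refine h2.congr_of_eventuallyEq ?_
  filter_upwards [(chartAt E₃ c).open_source.mem_nhds (mem_chart_source E₃ c)] with q hq
  simp only [Function.comp, fieldRep]
  rw [(chartAt E₃ c).left_inv hq]
  rfl

/-- Near a point, a plane field is the graph over a coordinate plane of a linear map that depends on
the point in a `C^r` manner. -/
theorem PlaneField.exists_graph {r : ℕ∞} (η : PlaneField r M) (p : M) :
    ∃ (W : Set E₃) (π : E₃ →L[ℝ] E₂) (S : E₃ → E₂ →L[ℝ] E₃), IsOpen W ∧ chartAt E₃ p p ∈ W ∧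
      W ⊆ (chartAt E₃ p).target ∧ ContDiffOn ℝ r S W ∧ (∀ u ∈ W, ∀ w, π (S u w) = w) ∧
      ∀ u ∈ W, ∀ v : TangentSpace (𝓡 3) ((chartAt E₃ p).symm u),
        v ∈ η.plane ((chartAt E₃ p).symm u) ↔
          S u (π (tangentCoord p _ v)) = tangentCoord p _ v := by
  obtain ⟨U, hU, hpU, V₁, V₂, hV₁, hV₂, hspan⟩ := η.exists_local_frame p
  set ψ := chartAt E₃ p with hψ
  set W₀ := ψ.target ∩ ψ.symm ⁻¹' U with hW₀
  have hW₀o : IsOpen W₀ := ψ.symm.isOpen_inter_preimage hU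
  have hpW₀ : ψ p ∈ W₀ := ⟨mem_chart_target E₃ p, by
    rw [mem_preimage, ψ.left_inv (mem_chart_source E₃ p)]; exact hpU⟩
  have h1 := contDiffOn_fieldRep hU hV₁ p
  have h2 := contDiffOn_fieldRep hU hV₂ p
  let A : E₃ → E₂ →L[ℝ] E₃ := fun u ↦
    (EuclideanSpace.proj 0 : E₂ →L[ℝ] ℝ).smulRight (fieldRep V₁ p u) +
    (EuclideanSpace.proj 1 : E₂ →L[ℝ] ℝ).smulRight (fieldRep V₂ p u)
  have hAapp : ∀ u w, A u w = w 0 • fieldRep V₁ p u + w 1 • fieldRep V₂ p u := fun u w ↦ rfl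
  have hA : ContDiffOn ℝ r A W₀ :=
    ((ContinuousLinearMap.smulRightL ℝ E₂ E₃ (EuclideanSpace.proj 0)).contDiff.comp_contDiffOn h1).add
      ((ContinuousLinearMap.smulRightL ℝ E₂ E₃ (EuclideanSpace.proj 1)).contDiff.comp_contDiffOn h2)
  have hinj : Function.Injective (A (ψ p)) := by
    have hq : ψ.symm (ψ p) ∈ ψ.source := ψ.map_target hpW₀.1
    have hfin := η.finrank_plane (ψ.symm (ψ p))
    rw [hspan _ hpW₀.2, ← Matrix.range_cons_cons_empty _ _ ![]] at hfin
    have hli : LinearIndependent ℝ ![V₁ (ψ.symm (ψ p)), V₂ (ψ.symm (ψ p))] :=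
      linearIndependent_iff_card_eq_finrank_span.2 (by rw [Set.finrank, hfin]; rfl)
    rw [injective_iff_map_eq_zero]
    intro w hw
    rw [hAapp] at hw
    have h3 : tangentCoordEquiv p _ hq (w 0 • V₁ (ψ.symm (ψ p)) + w 1 • V₂ (ψ.symm (ψ p))) = 0 := by
      rw [map_add, map_smul, map_smul]; exact hw
    rw [ContinuousLinearEquiv.map_eq_zero_iff] at h3
    obtain ⟨h4, h5⟩ := LinearIndependent.pair_iff.1 hli _ _ h3
    ext i; fin_cases i
    · exact h4
    · exact h5
  obtain ⟨π', hπ'⟩ := (A (ψ p) : E₂ →ₗ[ℝ] E₃).exists_leftInverse_of_injective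
    (LinearMap.ker_eq_bot.2 hinj)
  let π : E₃ →L[ℝ] E₂ := LinearMap.toContinuousLinearMap π'
  -- Since `π` inverts the frame map `A` on the left at `ψ p`, `π ∘ A u` is invertible nearby. Then
  -- `A u ∘ (B u)⁻¹` has the same image as `A u` and is a section of `π`.
  let B : E₃ → E₂ →L[ℝ] E₂ := fun u ↦ π.comp (A u)
  have hB : ContDiffOn ℝ r B W₀ := contDiffOn_const.clm_comp hA
  have hBp : B (ψ p) = 1 := by
    ext1 w
    exact congrArg (fun f ↦ f w) hπ'
  set W := W₀ ∩ B ⁻¹' {C | IsUnit C} with hW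
  have hWo : IsOpen W := hB.continuousOn.isOpen_inter_preimage hW₀o Units.isOpen
  have hinvm : ∀ u ∈ W, B u * Ring.inverse (B u) = 1 := fun u hu ↦ Ring.mul_inverse_cancel _ hu.2
  have hminv : ∀ u ∈ W, Ring.inverse (B u) * B u = 1 := fun u hu ↦ Ring.inverse_mul_cancel _ hu.2
  refine ⟨W, π, fun u ↦ (A u).comp (Ring.inverse (B u)), hWo, ⟨hpW₀, ?_⟩, fun u hu ↦ hu.1.1, ?_, ?_, ?_⟩
  · rw [mem_preimage, hBp]; exact isUnit_one
  · refine (hA.mono inter_subset_left).clm_comp fun u hu ↦ ?_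
    obtain ⟨C, hC⟩ := hu.2
    have h3 : ContDiffAt ℝ r Ring.inverse (B u) := hC ▸ contDiffAt_ringInverse ℝ C
    exact h3.comp_contDiffWithinAt u (hB.mono inter_subset_left u hu)
  · intro u hu w
    exact congrArg (fun f ↦ f w) (hinvm u hu)
  · intro u hu v
    have hq : ψ.symm u ∈ ψ.source := ψ.map_target hu.1.1
    have hA' : ∀ w, A u w = tangentCoordEquiv p _ hq (w 0 • V₁ (ψ.symm u) + w 1 • V₂ (ψ.symm u)) := by
      intro w
      rw [map_add, map_smul, map_smul]; rfl
    rw [hspan _ hu.1.2, Submodule.mem_span_pair, ← tangentCoordEquiv_apply p _ hq]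
    constructor
    · rintro ⟨a, b, rfl⟩
      have h4 := hA' !₂[a, b]
      simp only [Matrix.cons_val_zero, Matrix.cons_val_one] at h4
      rw [← h4]
      change A u (Ring.inverse (B u) (B u _)) = _
      exact congrArg (A u) (congrArg (fun f ↦ f !₂[a, b]) (hminv u hu))
    · intro h
      rw [ContinuousLinearMap.comp_apply, hA'] at h
      exact ⟨_, _, (tangentCoordEquiv p _ hq).injective h⟩

namespace PlaneField.Sections

variable {r : ℕ∞} {η : PlaneField r M}

/-- A finite-dimensional family of sections whose local expressions are jointly `C^r` is
continuous. -/
theorem continuous_of_contDiffOn {P : Type*} [NormedAddCommGroup P] [NormedSpace ℝ P]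
    {Y : P → η.Sections}
    (hY : ∀ c : M, ContDiffOn ℝ r (fun x : P × E₃ ↦ (Y x.1).localRep c x.2)
      (univ ×ˢ (chartAt E₃ c).target)) : Continuous Y := by
  refine continuous_iInf_rng.2 fun c ↦ continuous_iInf_rng.2 fun k ↦ continuous_iInf_rng.2 fun hk ↦
    continuous_induced_rng.2 ?_
  have hkr : (k : ℕ∞ω) ≤ r := by exact_mod_cast hk
  set T := (chartAt E₃ c).target
  have hT : IsOpen T := (chartAt E₃ c).open_target
  have hPT : IsOpen ((univ : Set P) ×ˢ T) := isOpen_univ.prod hT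
  set f : P × E₃ → E₃ := fun x ↦ (Y x.1).localRep c x.2 with hf
  -- the derivatives of the partial functions are restrictions of the joint derivatives
  have key : ∀ t, ∀ u ∈ T, iteratedFDeriv ℝ k ((Y t).localRep c) u =
      (iteratedFDerivWithin ℝ k f (univ ×ˢ T) (t, u)).compContinuousLinearMap
        fun _ ↦ ContinuousLinearMap.inr ℝ P E₃ := by
    intro t u hu
    let g : E₃ →ᴬ[ℝ] P × E₃ := (ContinuousAffineMap.const ℝ E₃ t).prod (ContinuousAffineMap.id ℝ E₃)
    have hg : g ⁻¹' (univ ×ˢ T) = T := by ext x; simp [g]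
    have h1 := (((hY c).of_le hkr).ftaylorSeriesWithin hPT.uniqueDiffOn).comp_continuousAffineMap g
    rw [hg] at h1
    rw [← iteratedFDerivWithin_of_isOpen k hT hu]
    exact (h1.eq_iteratedFDerivWithin_of_uniqueDiffOn le_rfl hT.uniqueDiffOn hu).symm
  rw [continuous_iff_continuousAt]
  intro t
  rw [ContinuousAt, UniformOnFun.tendsto_iff_tendstoUniformlyOn]
  rintro K ⟨hK, hKT⟩
  have hcont : ContinuousOn (Function.uncurry fun s u ↦ iteratedFDeriv ℝ k ((Y s).localRep c) u)
      (univ ×ˢ K) := by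
    have h1 := ((hY c).continuousOn_iteratedFDerivWithin hkr hPT.uniqueDiffOn).mono
      (prod_mono_right hKT : (univ : Set P) ×ˢ K ⊆ univ ×ˢ T)
    have h2 := (ContinuousMultilinearMap.compContinuousLinearMapL (𝕜 := ℝ) (F := E₃)
      (fun _ : Fin k ↦ ContinuousLinearMap.inr ℝ P E₃)).continuous.comp_continuousOn h1
    refine h2.congr ?_
    rintro ⟨s, u⟩ hsu
    exact key s u (hKT hsu.2)
  intro V hV
  -- Joint continuity and compactness of `K` make the convergence uniform on `K`.
  obtain ⟨v, hv, h⟩ := hK.mem_uniformity_of_prod hcont (mem_univ t) (symm_le_uniformity hV)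
  rw [nhdsWithin_univ] at hv
  filter_upwards [hv] with s hs u hu
  exact h s hs u hu

end PlaneField.Sections
end

/-! ### Perturbations supported in a chart, and openness of regularity -/

noncomputable section

local notation "E₂" => EuclideanSpace ℝ (Fin 2)
local notation "E₃" => EuclideanSpace ℝ (Fin 3)

variable {M : Type*} [TopologicalSpace M] [ChartedSpace E₃ M] [IsManifold (𝓡 3) ∞ M]

open Classical in
/-- The vector field with the expression `z` in the preferred chart at `p`, extended by zero. -/
def extendField (p : M) (z : E₃ → E₃) (q : M) : TangentSpace (𝓡 3) q :=
  if hq : q ∈ (chartAt E₃ p).source then (tangentCoordEquiv p q hq).symm (z (chartAt E₃ p q)) else 0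

lemma fieldRep_add (V₁ V₂ : ∀ q : M, TangentSpace (𝓡 3) q) (c : M) {u : E₃}
    (hu : u ∈ (chartAt E₃ c).target) :
    fieldRep (fun q ↦ V₁ q + V₂ q) c u = fieldRep V₁ c u + fieldRep V₂ c u := by
  have hq := (chartAt E₃ c).map_target hu
  simp only [fieldRep, ← tangentCoordEquiv_apply c _ hq, map_add]

lemma fieldRep_eq_zero_iff (V : ∀ q : M, TangentSpace (𝓡 3) q) (c : M) {u : E₃}
    (hu : u ∈ (chartAt E₃ c).target) :
    fieldRep V c u = 0 ↔ V ((chartAt E₃ c).symm u) = 0 := by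
  have hq := (chartAt E₃ c).map_target hu
  rw [fieldRep, ← tangentCoordEquiv_apply c _ hq, ContinuousLinearEquiv.map_eq_zero_iff]

lemma fieldRep_extendField_self (p : M) (z : E₃ → E₃) {u : E₃} (hu : u ∈ (chartAt E₃ p).target) :
    fieldRep (extendField p z) p u = z u := by
  have hq := (chartAt E₃ p).map_target hu
  rw [fieldRep, ← tangentCoordEquiv_apply p _ hq, extendField, dif_pos hq,
    ContinuousLinearEquiv.apply_symm_apply, (chartAt E₃ p).right_inv hu]

/-- On the overlap of the charts the expression is `z` under a `C^r` coordinate change. Elsewhere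
the point avoids the image of `K`, which is closed as `M` is Hausdorff, so the field vanishes
nearby. -/
lemma contDiffOn_fieldRep_extendField [T2Space M] {P : Type*} [NormedAddCommGroup P]
    [NormedSpace ℝ P] {r : ℕ∞} (p : M) {z : P → E₃ → E₃} (hz : ContDiff ℝ r (Function.uncurry z))
    {K : Set E₃} (hK : IsCompact K) (hKt : K ⊆ (chartAt E₃ p).target)
    (hz0 : ∀ t, ∀ u ∉ K, z t u = 0) (c : M) :
    ContDiffOn ℝ r (fun x : P × E₃ ↦ fieldRep (extendField p (z x.1)) c x.2)
      (univ ×ˢ (chartAt E₃ c).target) := by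
  have := contMDiffVectorBundle_tangent (M := M) r
  set ψ := chartAt E₃ p with hψ
  set φ := chartAt E₃ c with hφ
  set e := trivializationAt E₃ (TangentSpace (𝓡 3) : M → Type _) p
  set e' := trivializationAt E₃ (TangentSpace (𝓡 3) : M → Type _) c
  have hKc : IsClosed (ψ.symm '' K) := (hK.image_of_continuousOn (ψ.symm.continuousOn.mono hKt)).isClosed
  rintro ⟨t, u⟩ ⟨-, hu⟩
  refine ContDiffAt.contDiffWithinAt ?_
  by_cases hq : φ.symm u ∈ ψ.source
  · set O := φ.target ∩ φ.symm ⁻¹' ψ.source with hO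
    have hOo : IsOpen O := φ.symm.isOpen_inter_preimage ψ.open_source
    have hT : ContDiffOn ℝ r (fun v ↦ (e.coordChangeL ℝ e' (φ.symm v) : E₃ →L[ℝ] E₃)) O := by
      have h1 := contMDiffOn_coordChangeL (n := r) (IB := 𝓡 3) e e'
      refine (h1.comp ((contMDiffOn_symm_of_mem_maximalAtlas
        (chart_mem_maximalAtlas' r c)).mono inter_subset_left) ?_).contDiffOn
      intro v hv
      rw [mem_preimage, TangentBundle.trivializationAt_baseSet, TangentBundle.trivializationAt_baseSet]
      exact ⟨hv.2, φ.map_target hv.1⟩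
    have hτ : ContDiffOn ℝ r (ψ ∘ φ.symm) O :=
      ((contMDiffOn_of_mem_maximalAtlas (chart_mem_maximalAtlas' r p)).comp
        ((contMDiffOn_symm_of_mem_maximalAtlas (chart_mem_maximalAtlas' r c)).mono inter_subset_left)
        (fun v hv ↦ hv.2)).contDiffOn
    have huO : O ∈ 𝓝 u := hOo.mem_nhds ⟨hu, hq⟩
    have h2 : ContDiffAt ℝ r (fun x : P × E₃ ↦
        (e.coordChangeL ℝ e' (φ.symm x.2) : E₃ →L[ℝ] E₃) (z x.1 ((ψ ∘ φ.symm) x.2))) (t, u) := by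
      refine ContDiffAt.clm_apply ?_ ?_
      · exact ContDiffAt.comp (t, u) (f := Prod.snd) (hT.contDiffAt huO) contDiffAt_snd
      · exact hz.contDiffAt.comp (t, u) (contDiffAt_fst.prodMk
          (ContDiffAt.comp (t, u) (f := Prod.snd) (hτ.contDiffAt huO) contDiffAt_snd))
    refine h2.congr_of_eventuallyEq ?_
    filter_upwards [(hOo.preimage continuous_snd).mem_nhds (show (t, u).2 ∈ O from ⟨hu, hq⟩)] with x hx
    have hb : φ.symm x.2 ∈ e.baseSet ∩ e'.baseSet := by
      rw [TangentBundle.trivializationAt_baseSet, TangentBundle.trivializationAt_baseSet]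
      exact ⟨hx.2, φ.map_target hx.1⟩
    have hx2 : φ.symm x.2 ∈ ψ.source := hx.2
    rw [fieldRep, extendField, dif_pos hx2]
    exact (e.coordChangeL_apply e' hb _).symm
  · have hq' : φ.symm u ∉ ψ.symm '' K := by
      rintro ⟨v, hv, hvu⟩
      exact hq (hvu ▸ ψ.map_target (hKt hv))
    have hN : IsOpen (φ.target ∩ φ.symm ⁻¹' (ψ.symm '' K)ᶜ) :=
      φ.symm.isOpen_inter_preimage hKc.isOpen_compl
    refine (contDiffAt_const (c := 0)).congr_of_eventuallyEq ?_
    filter_upwards [(hN.preimage continuous_snd).mem_nhds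
      (show (t, u).2 ∈ φ.target ∩ φ.symm ⁻¹' (ψ.symm '' K)ᶜ from ⟨hu, hq'⟩)] with x hx
    rw [fieldRep_eq_zero_iff _ _ hx.1, extendField]
    split_ifs with h
    · rw [hz0, map_zero]
      intro hK'
      exact hx.2 ⟨_, hK', ψ.left_inv h⟩
    · rfl

namespace PlaneField.Sections

variable {r : ℕ∞} {η : PlaneField r M}

lemma contDiffOn_localRep (X : η.Sections) (c : M) :
    ContDiffOn ℝ r (X.localRep c) (chartAt E₃ c).target := by
  have h := contDiffOn_fieldRep (V := X.toField) isOpen_univ X.1.contMDiff.contMDiffOn c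
  rw [preimage_univ, inter_univ] at h
  exact h

/-- Perturbation of a section in a family of directions that are supported in a chart. -/
theorem exists_perturbation [T2Space M] {P : Type*} [NormedAddCommGroup P] [NormedSpace ℝ P]
    (X : η.Sections) (p : M) {z : P → E₃ → E₃} (hz : ContDiff ℝ r (Function.uncurry z))
    {K : Set E₃} (hK : IsCompact K) (hKt : K ⊆ (chartAt E₃ p).target)
    (hz0 : ∀ t, ∀ u ∉ K, z t u = 0)
    (hη : ∀ t, ∀ u ∈ (chartAt E₃ p).target, ∀ v, tangentCoord p ((chartAt E₃ p).symm u) v = z t u →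
      v ∈ η.plane ((chartAt E₃ p).symm u)) :
    ∃ Y : P → η.Sections, Continuous Y ∧
      (∀ t, ∀ u ∈ (chartAt E₃ p).target, (Y t).localRep p u = X.localRep p u + z t u) ∧
      ∀ t, z t = 0 → Y t = X := by
  let V : P → ∀ q : M, TangentSpace (𝓡 3) q := fun t q ↦ X.toField q + extendField p (z t) q
  have hVrep : ∀ c : M, ContDiffOn ℝ r (fun x : P × E₃ ↦ fieldRep (V x.1) c x.2)
      (univ ×ˢ (chartAt E₃ c).target) := by
    intro c
    refine ContDiffOn.congr (f := fun x : P × E₃ ↦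
      X.localRep c x.2 + fieldRep (extendField p (z x.1)) c x.2) ?_
      (fun x hx ↦ fieldRep_add _ _ c hx.2)
    exact ((X.contDiffOn_localRep c).comp contDiffOn_snd fun x hx ↦ hx.2).add
      (contDiffOn_fieldRep_extendField p hz hK hKt hz0 c)
  have hVs : ∀ t, ContMDiff (𝓡 3) (𝓡 3).tangent r
      (fun q ↦ (⟨q, V t q⟩ : TangentBundle (𝓡 3) M)) := fun t ↦
    contMDiff_of_fieldRep fun c ↦ (hVrep c).comp (f := fun u ↦ (t, u))
      (contDiff_const.prodMk contDiff_id).contDiffOn fun u hu ↦ ⟨mem_univ _, hu⟩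
  have hVη : ∀ t q, V t q ∈ η.plane q := by
    intro t q
    refine (η.plane q).add_mem (X.2 q) ?_
    rw [extendField]
    split_ifs with hq
    · have h := hη t _ ((chartAt E₃ p).map_source hq)
      rw [(chartAt E₃ p).left_inv hq] at h
      refine h _ ?_
      rw [← tangentCoordEquiv_apply p q hq, ContinuousLinearEquiv.apply_symm_apply]
    · exact Submodule.zero_mem _
  refine ⟨fun t ↦ ⟨⟨V t, hVs t⟩, hVη t⟩, continuous_of_contDiffOn hVrep, fun t u hu ↦ ?_, fun t ht ↦ ?_⟩
  · change fieldRep (V t) p u = _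
    rw [fieldRep_add _ _ p hu, fieldRep_extendField_self p _ hu]; rfl
  · refine Subtype.ext (ContMDiffSection.ext fun q ↦ ?_)
    change X.1 q + extendField p (z t) q = X.1 q
    rw [add_eq_left, extendField]
    split_ifs with hq
    · rw [ht, Pi.zero_apply, map_zero]
    · rfl

/-- Zero is a regular value, at the points of `K`, of the projection under `π` of the expression of
`X` in the preferred chart at `c`. -/
def RegularOn (c : M) (π : E₃ →L[ℝ] E₂) (K : Set E₃) (X : η.Sections) : Prop :=
  ∀ u ∈ K, π (X.localRep c u) = 0 → Function.Surjective (fderiv ℝ (fun u ↦ π (X.localRep c u)) u)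

/-- Regularity says that the 1-jet of `X` takes values in the open set `𝒢` over `K`. The jet image
of `K` is compact, so a thickening of it stays in `𝒢`, and nearby sections have uniformly close
jets. -/
theorem isOpen_regularOn (hr : 1 ≤ r) (c : M) (π : E₃ →L[ℝ] E₂) {K : Set E₃} (hK : IsCompact K)
    (hKt : K ⊆ (chartAt E₃ c).target) : IsOpen {X : η.Sections | RegularOn c π K X} := by
  have hr1 : (1 : ℕ∞ω) ≤ r := by exact_mod_cast hr
  let J₀ := continuousMultilinearCurryFin0 ℝ E₃ E₃
  let J₁ := continuousMultilinearCurryFin1 ℝ E₃ E₃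
  let 𝒢 : Set ((E₃ [×0]→L[ℝ] E₃) × (E₃ [×1]→L[ℝ] E₃)) :=
    {m | π (J₀ m.1) ≠ 0 ∨ Function.Surjective (π.comp (J₁ m.2))}
  have h𝒢 : IsOpen 𝒢 := by
    refine IsOpen.union ?_ ?_
    · exact isOpen_ne.preimage (π.continuous.comp (J₀.continuous.comp continuous_fst))
    · exact isOpen_surjective.preimage
        (continuous_const.clm_comp (J₁.continuous.comp continuous_snd))
  let jet : η.Sections → E₃ → (E₃ [×0]→L[ℝ] E₃) × (E₃ [×1]→L[ℝ] E₃) := fun X u ↦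
    (iteratedFDeriv ℝ 0 (X.localRep c) u, iteratedFDeriv ℝ 1 (X.localRep c) u)
  have hdiff : ∀ (X : η.Sections), ∀ u ∈ K, DifferentiableAt ℝ (X.localRep c) u := fun X u hu ↦
    ((X.contDiffOn_localRep c).contDiffAt ((chartAt E₃ c).open_target.mem_nhds
      (hKt hu))).differentiableAt (ne_of_gt (lt_of_lt_of_le one_pos hr1))
  have hiff : ∀ X : η.Sections, RegularOn c π K X ↔ ∀ u ∈ K, jet X u ∈ 𝒢 := by
    intro X
    refine forall₂_congr fun u hu ↦ ?_
    have h0 : J₀ (jet X u).1 = X.localRep c u := rfl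
    have h1 : J₁ (jet X u).2 = fderiv ℝ (X.localRep c) u := by
      ext1 v
      simp [J₁, jet]
    have h2 : fderiv ℝ (fun u ↦ π (X.localRep c u)) u = π.comp (fderiv ℝ (X.localRep c) u) :=
      (π.hasFDerivAt.comp u (hdiff X u hu).hasFDerivAt).fderiv
    rw [h2, ← h1, ← h0]
    exact imp_iff_not_or
  have hunif : ∀ (k : ℕ), (k : ℕ∞) ≤ r → ∀ X : η.Sections, TendstoUniformlyOn
      (fun (Y : η.Sections) u ↦ iteratedFDeriv ℝ k (Y.localRep c) u)
      (iteratedFDeriv ℝ k (X.localRep c)) (𝓝 X) K := by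
    intro k hk X
    have h1 : Continuous (fun X : η.Sections ↦ UniformOnFun.ofFun
        {K : Set E₃ | IsCompact K ∧ K ⊆ (chartAt E₃ c).target}
        (iteratedFDeriv ℝ k (X.localRep c))) :=
      continuous_iInf_dom (i := c) (continuous_iInf_dom (i := k) (continuous_iInf_dom (i := hk)
        continuous_induced_dom))
    exact UniformOnFun.tendsto_iff_tendstoUniformlyOn.1 (h1.tendsto X) K ⟨hK, hKt⟩
  rw [isOpen_iff_mem_nhds]
  intro X hX
  have hjc : ContinuousOn (jet X) K := by
    have h1 : ∀ k : ℕ, (k : ℕ∞ω) ≤ r → ContinuousOn (iteratedFDeriv ℝ k (X.localRep c)) K := by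
      intro k hk
      refine (((X.contDiffOn_localRep c).continuousOn_iteratedFDerivWithin hk
        (chartAt E₃ c).open_target.uniqueDiffOn).congr fun u hu ↦ ?_).mono hKt
      exact (iteratedFDerivWithin_of_isOpen k (chartAt E₃ c).open_target hu).symm
    exact (h1 0 (by simp)).prodMk (h1 1 (by simpa using hr1))
  obtain ⟨ε, hε, hth⟩ := (hK.image_of_continuousOn hjc).exists_thickening_subset_open h𝒢
    (image_subset_iff.2 ((hiff X).1 hX))
  filter_upwards [Metric.tendstoUniformlyOn_iff.1 (hunif 0 (by simp) X) ε hε,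
    Metric.tendstoUniformlyOn_iff.1 (hunif 1 (by simpa using hr) X) ε hε] with Y h0 h1
  refine (hiff Y).2 fun u hu ↦ hth ?_
  refine Metric.mem_thickening_iff.2 ⟨_, ⟨u, hu, rfl⟩, ?_⟩
  rw [dist_comm, Prod.dist_eq, max_lt_iff]
  exact ⟨h0 u hu, h1 u hu⟩

end PlaneField.Sections
end

/-! ### Density of regularity -/

noncomputable section

local notation "E₂" => EuclideanSpace ℝ (Fin 2)
local notation "E₃" => EuclideanSpace ℝ (Fin 3)

variable {M : Type*} [TopologicalSpace M] [ChartedSpace E₃ M] [IsManifold (𝓡 3) ∞ M]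

lemma contDiff_of_contDiffOn_of_eq_zero {E F : Type*} [NormedAddCommGroup E] [NormedSpace ℝ E]
    [NormedAddCommGroup F] [NormedSpace ℝ F] {n : ℕ∞ω} {f : E → F} {O C : Set E} (hO : IsOpen O)
    (hC : IsClosed C) (hCO : C ⊆ O) (hf : ContDiffOn ℝ n f O) (h0 : ∀ x ∉ C, f x = 0) :
    ContDiff ℝ n f := by
  rw [contDiff_iff_contDiffAt]
  intro x
  by_cases hx : x ∈ C
  · exact hf.contDiffAt (hO.mem_nhds (hCO hx))
  · refine (contDiffAt_const (c := 0)).congr_of_eventuallyEq ?_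
    filter_upwards [hC.isOpen_compl.mem_nhds hx] with y hy using h0 y hy

lemma exists_contDiff_cutoff {K W : Set E₃} (hK : IsCompact K) (hW : IsOpen W) (hKW : K ⊆ W) :
    ∃ (χ : E₃ → ℝ) (C : Set E₃), ContDiff ℝ ∞ χ ∧ IsCompact C ∧ C ⊆ W ∧ (∀ u ∉ C, χ u = 0) ∧
      ∀ u ∈ K, ∀ᶠ v in 𝓝 u, χ v = 1 := by
  obtain ⟨C, hC, hKC, hCW⟩ := exists_compact_between hK hW hKW
  obtain ⟨f, h1, h0, -⟩ := exists_contMDiffMap_one_nhds_of_subset_interior (n := ⊤) 𝓘(ℝ, E₃)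
    hK.isClosed hKC
  exact ⟨f, C, f.contMDiff.contDiff, hC, hCW, h0, fun u hu ↦
    h1.filter_mono (nhds_le_nhdsSet hu)⟩

namespace PlaneField.Sections

variable {r : ℕ∞} {η : PlaneField r M}

/-- Near `K` the perturbation replaces `π X` by its mollification plus an affine map, and the lift
`S` keeps the result tangent to `η`. Generic parameters arbitrarily close to zero make it regular.
-/
theorem dense_regularOn [T2Space M] (p : M) {W : Set E₃} {π : E₃ →L[ℝ] E₂}
    {S : E₃ → E₂ →L[ℝ] E₃} (hW : IsOpen W) (hWt : W ⊆ (chartAt E₃ p).target)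
    (hS : ContDiffOn ℝ r S W) (hπS : ∀ u ∈ W, ∀ w, π (S u w) = w)
    (hη : ∀ u ∈ W, ∀ v : TangentSpace (𝓡 3) ((chartAt E₃ p).symm u),
      v ∈ η.plane ((chartAt E₃ p).symm u) ↔ S u (π (tangentCoord p _ v)) = tangentCoord p _ v)
    {K : Set E₃} (hK : IsCompact K) (hKW : K ⊆ W) :
    Dense {X : η.Sections | RegularOn p π K X} := by
  intro X
  obtain ⟨χ, C, hχ, hC, hCW, hχ0, hχ1⟩ := exists_contDiff_cutoff hK hW hKW
  have hχr : ContDiff ℝ r χ := hχ.of_le (by exact_mod_cast le_top)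
  let F₀ : E₃ → E₂ := fun u ↦ χ u • π (X.localRep p u)
  have hF₀ : ContDiff ℝ r F₀ := contDiff_of_contDiffOn_of_eq_zero hW hC.isClosed hCW
    (hχr.contDiffOn.smul (π.contDiff.comp_contDiffOn ((X.contDiffOn_localRep p).mono hWt)))
    fun u hu ↦ by simp only [F₀, hχ0 u hu, zero_smul]
  obtain ⟨G, hG, hG0, hG2⟩ := exists_mollification hF₀
  -- Subtracting `F₀` cancels `π X` where `χ = 1`, leaving `G (δ, ·)` plus the affine term. At the
  -- zero parameter `H` vanishes.
  let H : ℝ × (E₂ × (E₃ →L[ℝ] E₂)) → E₃ → E₂ := fun t u ↦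
    G (t.1, u) - F₀ u + (t.2.1 + t.2.2 u)
  have hH : ContDiff ℝ r (Function.uncurry H) := by
    refine ContDiff.add ((hG.comp (g := G) (contDiff_fst.fst.prodMk contDiff_snd)).sub
      (hF₀.comp contDiff_snd)) (ContDiff.add ?_ ?_)
    · exact contDiff_fst.snd.fst
    · exact contDiff_fst.snd.snd.clm_apply contDiff_snd
  let z : ℝ × (E₂ × (E₃ →L[ℝ] E₂)) → E₃ → E₃ := fun t u ↦ χ u • S u (H t u)
  have hz0 : ∀ t, ∀ u ∉ C, z t u = 0 := fun t u hu ↦ by simp only [z, hχ0 u hu, zero_smul]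
  have hz : ContDiff ℝ r (Function.uncurry z) := by
    refine contDiff_of_contDiffOn_of_eq_zero (hW.preimage continuous_snd)
      (hC.isClosed.preimage continuous_snd) (preimage_mono hCW) ?_ fun x hx ↦ hz0 x.1 x.2 hx
    exact ((hχr.comp contDiff_snd).contDiffOn).smul
      ((hS.comp contDiffOn_snd fun x hx ↦ hx).clm_apply hH.contDiffOn)
  obtain ⟨Y, hYc, hYrep, hYX⟩ := X.exists_perturbation p hz hC (hCW.trans hWt) hz0 (by
    intro t u hu v hv
    by_cases huW : u ∈ W
    · rw [hη u huW, hv]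
      simp only [z, map_smul, hπS u huW]
    · rw [hz0 t u (fun h ↦ huW (hCW h)), ← tangentCoordEquiv_apply p _
        ((chartAt E₃ p).map_target hu), ContinuousLinearEquiv.map_eq_zero_iff] at hv
      rw [hv]
      exact Submodule.zero_mem _)
  have hY0 : Y 0 = X := hYX 0 <| funext fun u ↦ by
    have : H 0 u = 0 := by simp [H, hG0]
    simp only [z, this, map_zero, smul_zero, Pi.zero_apply]
  let 𝒟 : Set (ℝ × (E₂ × (E₃ →L[ℝ] E₂))) := {t | t.1 ≠ 0 ∧ ∀ u,
    G (t.1, u) + (t.2.1 + t.2.2 u) = 0 →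
      Function.Surjective (fderiv ℝ (fun u ↦ G (t.1, u)) u + t.2.2)}
  -- The scale `δ ≠ 0` is chosen first. The good affine maps are dense for each such `δ`.
  have h𝒟 : (0 : ℝ × (E₂ × (E₃ →L[ℝ] E₂))) ∈ closure 𝒟 := by
    rw [mem_closure_iff_nhds]
    intro N hN
    obtain ⟨N₁, hN₁, N₂, hN₂, hNN⟩ := mem_nhds_prod_iff.1 hN
    obtain ⟨δ, hδ, hδ0⟩ := mem_closure_iff_nhds.1 (dense_compl_singleton (0 : ℝ) 0) N₁ hN₁
    obtain ⟨b, hb, hbG⟩ := mem_closure_iff_nhds.1 (dense_affine_perturbations (hG2 δ hδ0) 0) N₂ hN₂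
    exact ⟨(δ, b), hNN ⟨hδ, hb⟩, hδ0, hbG⟩
  rw [← hY0]
  refine map_mem_closure hYc h𝒟 ?_
  rintro ⟨δ, b⟩ ⟨hδ, hb⟩ u hu hYu
  have heq : ∀ v ∈ W, χ v = 1 → π ((Y (δ, b)).localRep p v) = G (δ, v) + (b.1 + b.2 v) := by
    intro v hv hv1
    rw [hYrep _ v (hWt hv), map_add]
    simp only [z, H, F₀, hv1, one_smul, hπS v hv]
    abel
  have hev : (fun v ↦ π ((Y (δ, b)).localRep p v)) =ᶠ[𝓝 u] fun v ↦ G (δ, v) + (b.1 + b.2 v) := by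
    filter_upwards [hW.mem_nhds (hKW hu), hχ1 u hu] with v hv hv1 using heq v hv hv1
  rw [hev.fderiv_eq]
  have hd : HasFDerivAt (fun v ↦ G (δ, v)) (fderiv ℝ (fun v ↦ G (δ, v)) u) u :=
    (((hG2 δ hδ).differentiable (by simp)) u).hasFDerivAt
  have hd' : HasFDerivAt (fun v ↦ G (δ, v) + (b.1 + b.2 v)) _ u :=
    hd.add (b.2.hasFDerivAt.const_add b.1)
  rw [hd'.fderiv]
  exact hb u (by rw [← heq u (hKW hu) (hχ1 u hu).self_of_nhds]; exact hYu)

lemma isClosed_fixedPoints (X : η.Sections) : IsClosed X.fixedPoints := by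
  rw [← isOpen_compl_iff, isOpen_iff_mem_nhds]
  intro p hp
  have hiff : ∀ q ∈ (chartAt E₃ p).source,
      X.localRep p (chartAt E₃ p q) = 0 ↔ q ∈ X.fixedPoints := by
    intro q hq
    have h := fieldRep_eq_zero_iff X.toField p ((chartAt E₃ p).map_source hq)
    rw [(chartAt E₃ p).left_inv hq] at h
    exact h
  have hps := mem_chart_source E₃ p
  have hc : ContinuousAt (fun q ↦ X.localRep p (chartAt E₃ p q)) p :=
    ((X.contDiffOn_localRep p).continuousOn.continuousAt ((chartAt E₃ p).open_target.mem_nhds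
      (mem_chart_target E₃ p))).comp ((chartAt E₃ p).continuousAt hps)
  filter_upwards [hc.eventually_ne (fun h ↦ hp ((hiff p hps).1 h)),
    (chartAt E₃ p).open_source.mem_nhds hps] with q hq hqs h
  exact hq ((hiff q hqs).2 h)

end PlaneField.Sections
end

/-! ### Conclusion -/

theorem mainTheorem9 {M : Type*} [TopologicalSpace M] [T2Space M] [CompactSpace M]
    [ChartedSpace (EuclideanSpace ℝ (Fin 3)) M] [IsManifold (𝓡 3) ∞ M]
    (r : ℕ∞) (hr : 1 ≤ r) (η : PlaneField r M) :
    ∃ 𝒰 : Set η.Sections, IsOpen 𝒰 ∧ Dense 𝒰 ∧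
      ∀ X ∈ 𝒰, IsFiniteLink r X.fixedPoints := by
  choose W π S hWo hpW hWt hS hπS hη using η.exists_graph
  choose K hK hpK hKW using fun p ↦ exists_compact_subset (hWo p) (hpW p)
  let N : M → Set M := fun p ↦ (chartAt (EuclideanSpace ℝ (Fin 3)) p).source ∩
    (chartAt (EuclideanSpace ℝ (Fin 3)) p) ⁻¹' interior (K p)
  obtain ⟨s, hs⟩ := CompactSpace.elim_nhds_subcover N fun p ↦
    ((chartAt (EuclideanSpace ℝ (Fin 3)) p).isOpen_inter_preimage isOpen_interior).mem_nhds
      ⟨mem_chart_source _ p, hpK p⟩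
  have hopen : ∀ p, IsOpen {X : η.Sections | X.RegularOn p (π p) (K p)} := fun p ↦
    PlaneField.Sections.isOpen_regularOn hr p (π p) (hK p) ((hKW p).trans (hWt p))
  have hdense : ∀ p, Dense {X : η.Sections | X.RegularOn p (π p) (K p)} := fun p ↦
    PlaneField.Sections.dense_regularOn p (hWo p) (hWt p) (hS p) (hπS p) (hη p) (hK p) (hKW p)
  -- The intersection is finite and the sets are open, so no Baire property is needed.
  have hdense_inter : ∀ s : Finset M,
      Dense (⋂ p ∈ s, {X : η.Sections | X.RegularOn p (π p) (K p)}) := by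
    classical
    intro s
    induction s using Finset.induction_on with
    | empty => simp
    | insert p s _ ih =>
      rw [Finset.set_biInter_insert]
      exact (hdense p).inter_of_isOpen_left ih (hopen p)
  refine ⟨⋂ p ∈ s, {X : η.Sections | X.RegularOn p (π p) (K p)},
    isOpen_biInter_finset fun p _ ↦ hopen p, hdense_inter s,
    fun X hX ↦ ?_⟩
  refine isFiniteLink_of_isStraight hr X.isClosed_fixedPoints fun q hq ↦ ?_
  have hqN : q ∈ ⋃ p ∈ s, N p := hs.symm ▸ mem_univ q
  obtain ⟨p, hp, hqs, hqK⟩ := mem_iUnion₂.1 hqN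
  have hqW := hKW p (interior_subset hqK)
  have hiff : ∀ q' ∈ (chartAt (EuclideanSpace ℝ (Fin 3)) p).source,
      chartAt (EuclideanSpace ℝ (Fin 3)) p q' ∈ W p →
      (q' ∈ X.fixedPoints ↔ π p (X.localRep p (chartAt (EuclideanSpace ℝ (Fin 3)) p q')) = 0) := by
    intro q' hq' hqW'
    have h := fieldRep_eq_zero_iff X.toField p (hWt p hqW')
    rw [(chartAt _ p).left_inv hq'] at h
    refine h.symm.trans ⟨fun h0 ↦ ?_, fun h0 ↦ ?_⟩
    · rw [localRep_eq_fieldRep, h0, map_zero]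
    -- `X` is recovered as `S (π X)`, so it vanishes where `π X` does.
    · refine ((hη p _ hqW' _).1 (X.2 _)).symm.trans ?_
      refine (congrArg (S p _) h0).trans (map_zero _)
  exact exists_isStraight_of_regular hr (chart_mem_maximalAtlas' r p) hqs (hWo p) hqW
    ((π p).contDiff.comp_contDiffOn ((X.contDiffOn_localRep p).mono (hWt p))) hiff
    (mem_iInter₂.1 hX p hp _ (interior_subset hqK) ((hiff q hqs hqW).1 hq))
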